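/- Let $A=\{a_1,\dots,a_n\}$ be a finite alphabet with $n\ge 2$ letters, listed in a fixed order. Consider first-order logic (with equality) over the structure of all finite words over $A$ with the subword (scattered subsequence) relation $\sqsubseteq$ and a constant for every word of $A^*$. A formula with alternation bounds is a formula $\varphi$ together with a map $b$ from the set of all variables to $\mathbb{N}\cup\{\infty\}$; its satisfying assignments are those that satisfy $\varphi$ when each quantifier over a variable $x$ with $b(x)<\infty$ is restricted to the words in $(a_1^*\cdots a_n^*)^{b(x)}$, and that moreover send each free variable $x$ of $\varphi$ with $b(x)<\infty$ into $(a_1^*\cdots a_n^*)^{b(x)}$. The fragment $\Sigma_{1,0}$ consists of those formulas with alternation bounds for which $\varphi$ is a $\Sigma_1$ formula (existential quantifiers followed by a quantifier-free formula) and $b(x)<\infty$ for every variable $x$. A language $L\subseteq A^*$ is definable in $\Sigma_{1,0}$ if there is a formula in $\Sigma_{1,0}$ with exactly one free variable $x$ such that $L$ is the set of values of $x$ under the satisfying assignments. For a finite set $V$ and a partition $P$ of $V$ into blocks $V_1,\dots,V_n$ (possibly empty), a semilinear set $S\subseteq\mathbb{N}^V$ is called $P$-compatible if it is a finite union of linear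 sets, each given by a base vector and a finite set of period vectors, such that each period vector occurring in this representation vanishes outside one of the blocks $V_i$. **Theorem.** Let $\ell\in\mathbb{N}$ and $L\subseteq(a_1^*\cdots a_n^*)^\ell$. Let $V=\{x_{i,j}\mid 1\le i\le \ell,\ 1\le j\le n\}$ and let $P=\{V_1,\dots,V_n\}$ be the partition of $V$ with $V_j=\{x_{i,j}\mid 1\le i\le \ell\}$. Then $L$ is definable in $\Sigma_{1,0}$ if and only if $$S=\{\alpha\in\mathbb{N}^V\mid a_1^{\alpha(x_{1,1})}\cdots a_n^{\alpha(x_{1,n})}\cdots a_1^{\alpha(x_{\ell,1})}\cdots a_n^{\alpha(x_{\ell,n})}\in L\}$$ is a $P$-compatible semilinear set. In particular, for any two distinct letters $a,b\in A$, the language $\{a^kba^k\mid k\in\mathbb{N}\}$ is definable in $\Sigma_{1,0}$, but $\{a^kb^k\mid k\in\mathbb{N}\}$ is not. -/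

import Mathlib

open scoped Pointwise

/-! First-order logic over the subword ordering, with all words as constants.
The alphabet with letters `a_1, …, a_n` is `Fin n`, in its natural enumeration; words are lists of
letters, the subword relation is `List.Sublist`, and languages are `Language (Fin n)`. -/

namespace SubwordLogic

/-- The language `a_1^* a_2^* ⋯ a_n^*`. -/
def letterBlock (n : ℕ) : Language (Fin n) :=
  (List.ofFn fun j : Fin n => KStar.kstar ({[j]} : Language (Fin n))).prod

/-- The language `(a_1^* ⋯ a_n^*)^b` for a bound `b ∈ ℕ ∪ {∞}`; for `b = ∞` it contains every
word. -/
def altBounded (n : ℕ) (b : ℕ∞) : Language (Fin n) :=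
  {w | ∀ k : ℕ, b = (k : ℕ∞) → w ∈ letterBlock n ^ k}

/-- Terms: variables (named by natural numbers) and constants (one for each word). -/
inductive Term (n : ℕ) : Type
  | var (x : ℕ) : Term n
  | const (w : List (Fin n)) : Term n

/-- The value of a term under an assignment. -/
def Term.val {n : ℕ} (α : ℕ → List (Fin n)) : Term n → List (Fin n)
  | .var x => α x
  | .const w => w

/-- The variables of a term. -/
def Term.vars {n : ℕ} : Term n → Finset ℕ
  | .var x => {x}
  | .const _ => ∅

/-- First-order formulas (with equality) over the signature with the subword relation and a
constant for every word. -/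
inductive Formula (n : ℕ) : Type
  | eq (s t : Term n) : Formula n
  | subword (s t : Term n) : Formula n
  | not (φ : Formula n) : Formula n
  | and (φ ψ : Formula n) : Formula n
  | or (φ ψ : Formula n) : Formula n
  | ex (x : ℕ) (φ : Formula n) : Formula n
  | all (x : ℕ) (φ : Formula n) : Formula n

namespace Formula

variable {n : ℕ}

/-- The free variables of a formula. -/
def freeVars : Formula n → Finset ℕ
  | eq s t => s.vars ∪ t.vars
  | subword s t => s.vars ∪ t.vars
  | not φ => φ.freeVars
  | and φ ψ => φ.freeVars ∪ ψ.freeVars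
  | or φ ψ => φ.freeVars ∪ ψ.freeVars
  | ex x φ => φ.freeVars.erase x
  | all x φ => φ.freeVars.erase x

/-- Quantifier-free formulas. -/
def IsQF : Formula n → Prop
  | eq _ _ => True
  | subword _ _ => True
  | not φ => φ.IsQF
  | and φ ψ => φ.IsQF ∧ ψ.IsQF
  | or φ ψ => φ.IsQF ∧ ψ.IsQF
  | ex _ _ => False
  | all _ _ => False

/-- `Σ₁` formulas: a block of existential quantifiers in front of a quantifier-free formula. -/
inductive IsSigmaOne : Formula n → Prop
  | qf {φ : Formula n} (h : φ.IsQF) : IsSigmaOne φ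
  | ex (x : ℕ) {φ : Formula n} (h : IsSigmaOne φ) : IsSigmaOne (ex x φ)

/-- Truth of a formula under the assignment `α`, where each quantifier over a variable `x` is
relativised to the words in `(a_1^* ⋯ a_n^*)^(b x)`. -/
def Holds (b : ℕ → ℕ∞) : Formula n → (ℕ → List (Fin n)) → Prop
  | eq s t, α => s.val α = t.val α
  | subword s t, α => (s.val α).Sublist (t.val α)
  | not φ, α => ¬ φ.Holds b α
  | and φ ψ, α => φ.Holds b α ∧ ψ.Holds b α
  | or φ ψ, α => φ.Holds b α ∨ ψ.Holds b α
  | ex x φ, α => ∃ w ∈ altBounded n (b x), φ.Holds b (Function.update α x w)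
  | all x φ, α => ∀ w ∈ altBounded n (b x), φ.Holds b (Function.update α x w)

end Formula

/-- A formula with alternation bounds: a formula together with a bound in `ℕ ∪ {∞}` for every
variable. -/
structure BoundedFormula (n : ℕ) where
  formula : Formula n
  bound : ℕ → ℕ∞

namespace BoundedFormula

variable {n : ℕ}

/-- The satisfying assignments of a formula with alternation bounds: the quantifiers are
relativised, and each free variable has to respect its bound too. -/
def sat (Φ : BoundedFormula n) : Set (ℕ → List (Fin n)) :=
  {α | Φ.formula.Holds Φ.bound α ∧ ∀ x ∈ Φ.formula.freeVars, α x ∈ altBounded n (Φ.bound x)}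

/-- The fragment `Σ_{1,j}`: `Σ₁` formulas with at most `j` alternation unbounded variables. -/
def InSigmaOne (j : ℕ) (Φ : BoundedFormula n) : Prop :=
  Φ.formula.IsSigmaOne ∧ {x : ℕ | Φ.bound x = ⊤}.encard ≤ (j : ℕ∞)

end BoundedFormula

/-- A language is definable in `Σ_{1,j}` if it is the set of values of the only free variable of a
formula from this fragment under the satisfying assignments. -/
def DefinableSigmaOne {n : ℕ} (j : ℕ) (L : Language (Fin n)) : Prop :=
  ∃ (Φ : BoundedFormula n) (x : ℕ), Φ.InSigmaOne j ∧ Φ.formula.freeVars = {x} ∧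
    L = {w | ∃ α ∈ Φ.sat, α x = w}

/-- A set of vectors is `P`-compatible, for a partition `P` of the set of coordinates, if it has a
semilinear representation (finitely many pairs of a base vector and a finite set of period vectors)
in which every period vector vanishes outside some block of `P`. -/
def IsPCompatible {V κ : Type*} (P : κ → Set V) (S : Set (V → ℕ)) : Prop :=
  ∃ R : Finset ((V → ℕ) × Finset (V → ℕ)),
    (∀ r ∈ R, ∀ p ∈ r.2, ∃ i : κ, ∀ v, v ∉ P i → p v = 0) ∧
    S = ⋃ r ∈ R, r.1 +ᵥ (AddSubmonoid.closure (r.2 : Set (V → ℕ)) : Set (V → ℕ))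

/-- The partition of the variables `x_{i,j}` that groups the exponents of the same letter:
`V_j = {x_{i,j} | i}`. -/
def letterPartition (ℓ n : ℕ) (j : Fin n) : Set (Fin ℓ × Fin n) := {x | x.2 = j}

/-- The word `a_1^α(x_{1,1}) ⋯ a_n^α(x_{1,n}) ⋯ a_1^α(x_{ℓ,1}) ⋯ a_n^α(x_{ℓ,n})`. -/
def expWord {ℓ n : ℕ} (α : Fin ℓ × Fin n → ℕ) : List (Fin n) :=
  (List.ofFn fun i : Fin ℓ =>
    (List.ofFn fun j : Fin n => List.replicate (α (i, j)) j).flatten).flatten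

/-- The set of exponent vectors of the words in `L`. -/
def exponents {n : ℕ} (ℓ : ℕ) (L : Language (Fin n)) : Set (Fin ℓ × Fin n → ℕ) :=
  {α | expWord α ∈ L}

end SubwordLogic

/-!
Within the alternation bounds, a word is given by the exponents of its runs, so a relation between
bounded words becomes a set of exponent vectors, and definability is compared with
semilinearity.

*From formulas to semilinear sets.* The sets of exponent vectors that are finite unions of boxes,
one semilinear factor for each letter (`IsLetterwise`), form a Boolean algebra, because the
semilinear sets do, and they are closed under projections. The subword relation gives such a set
(`isLetterwise_runWord_sublist`): in comparing two words run by run, exponents only meet when they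
belong to the same letter. Hence every `Σ₁` formula with bounded variables gives a letterwise set,
and a box, being the sum of its factors, has a representation in which every period belongs to one
letter (`IsLetterwise.isPCompatible`).

*From semilinear sets to formulas.* The first point is that the successor on powers of a letter `a`
is definable (`EDef.succ`). Presence and absence of subwords express inequalities `x ≤ y + c` and
`y < x` between exponents of words of different shapes, and with a second letter `b` available a
cycle of such inequalities can be closed up without slack, which forces an equality. The successor
yields counting of letters, and the words `a^p b a^q` yield addition, so linear functions of the
numbers of letters `a` are definable. Finally a word is determined by its letter counts and its
subwords `a^i b^j` (`eq_of_count_eq_of_replicate_append_sublist`); for a word with few runs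
finitely many of these suffice, one for each cut between two runs (`eq_runWord_iff`), and for
exponents in a compatible linear set both `i` and `j` are linear functions of the coefficients of
periods that belong to a single letter.

*Examples.* The exponents of `a^k b a^k` form a linear set whose only period belongs to the letter
`a`. In a compatible representation for `a^k b^k` a period changes the number of one letter only,
which is impossible unless it leaves the word unchanged.
-/

namespace SubwordLogic

/-! ### Words given by runs -/

/-- The word whose `t`-th run is a power of the letter `(R[t]).2`, with exponent `e R[t]`.
Exponents may be `0` and neighbouring runs may have the same letter. -/
def runWord {Y κ : Type*} (R : List (Y × κ)) (e : Y × κ → ℕ) : List κ :=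
  (R.map fun v => List.replicate (e v) v.2).flatten

section runWord

variable {Y X κ : Type*}

@[simp] lemma runWord_nil (e : Y × κ → ℕ) : runWord [] e = [] := rfl

@[simp] lemma runWord_cons (v : Y × κ) (R : List (Y × κ)) (e : Y × κ → ℕ) :
    runWord (v :: R) e = List.replicate (e v) v.2 ++ runWord R e := rfl

lemma runWord_append (R R' : List (Y × κ)) (e : Y × κ → ℕ) :
    runWord (R ++ R') e = runWord R e ++ runWord R' e := by
  simp [runWord]

lemma runWord_congr {R : List (Y × κ)} {e e' : Y × κ → ℕ} (h : ∀ v ∈ R, e v = e' v) :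
    runWord R e = runWord R e' := by
  unfold runWord
  congr 1
  exact List.map_congr_left fun v hv => by rw [h v hv]

lemma runWord_map (g : Y → X) (R : List (Y × κ)) (e : X × κ → ℕ) :
    runWord (R.map (Prod.map g id)) e = runWord R fun v => e (g v.1, v.2) := by
  simp [runWord, Function.comp_def, Prod.map]

lemma runWord_eq_self_of_eq_one (y : Y) (w : List κ) (e : Y × κ → ℕ) (h : ∀ j, e (y, j) = 1) :
    runWord (w.map fun j => (y, j)) e = w := by
  induction w with
  | nil => rfl
  | cons a w ih => simp [ih, h]

lemma count_runWord [DecidableEq κ] (a : κ) (R : List (Y × κ)) (e : Y × κ → ℕ) :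
    (runWord R e).count a = (R.map fun v => if v.2 = a then e v else 0).sum := by
  induction R with
  | nil => rfl
  | cons v R ih => simp [ih, List.count_replicate]

end runWord

/-- The runs of the words in `(a_1^* ⋯ a_n^*)^ℓ`, from left to right. -/
def allRuns (ℓ n : ℕ) : List (Fin ℓ × Fin n) :=
  (List.finRange ℓ).flatMap fun i => (List.finRange n).map fun j => (i, j)

lemma expWord_eq_runWord {ℓ n : ℕ} (α : Fin ℓ × Fin n → ℕ) :
    expWord α = runWord (allRuns ℓ n) α := by
  simp only [expWord, runWord, allRuns, List.ofFn_eq_map, List.flatMap, List.map_flatten,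
    List.map_map, List.flatten_flatten, Function.comp_def]

/-! ### The languages `(a_1^* ⋯ a_n^*)^ℓ` -/

lemma mem_kstar_singleton_letter {κ : Type*} (j : κ) (w : List κ) :
    w ∈ KStar.kstar ({[j]} : Language κ) ↔ ∃ k, w = List.replicate k j := by
  rw [Language.mem_kstar]
  constructor
  · rintro ⟨M, rfl, hM⟩
    refine ⟨M.length, ?_⟩
    induction M with
    | nil => rfl
    | cons x M ih =>
      have hx : x = [j] := hM x (by simp)
      simp [hx, ih fun y hy => hM y (by simp [hy]), List.replicate_succ]
  · rintro ⟨k, rfl⟩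
    refine ⟨List.replicate k [j], by simp, fun y hy => ?_⟩
    rw [List.eq_of_mem_replicate hy]
    rfl

lemma mem_prod_kstar_letter {κ : Type*} {m : ℕ} (g : Fin m → κ) (w : List κ) :
    w ∈ (List.ofFn fun j => KStar.kstar ({[g j]} : Language κ)).prod ↔
      ∃ f : Fin m → ℕ, w = (List.ofFn fun j => List.replicate (f j) (g j)).flatten := by
  induction m generalizing w with
  | zero => simp [Language.mem_one]
  | succ m ih =>
    simp only [List.ofFn_succ, List.prod_cons, List.flatten_cons, Language.mem_mul, ih,
      mem_kstar_singleton_letter]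
    constructor
    · rintro ⟨_, ⟨k, rfl⟩, _, ⟨f, rfl⟩, rfl⟩
      exact ⟨Fin.cons k f, by simp⟩
    · rintro ⟨f, rfl⟩
      exact ⟨_, ⟨f 0, rfl⟩, _, ⟨fun j => f j.succ, rfl⟩, rfl⟩

lemma mem_letterBlock_pow {n : ℕ} (ℓ : ℕ) (w : List (Fin n)) :
    w ∈ letterBlock n ^ ℓ ↔ ∃ α : Fin ℓ × Fin n → ℕ, w = expWord α := by
  induction ℓ generalizing w with
  | zero => simp [Language.mem_one, expWord]
  | succ ℓ ih =>
    simp only [pow_succ', Language.mem_mul, ih, expWord, List.ofFn_succ, List.flatten_cons]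
    simp only [letterBlock, mem_prod_kstar_letter]
    constructor
    · rintro ⟨_, ⟨k, rfl⟩, _, ⟨f, rfl⟩, rfl⟩
      exact ⟨fun v => (Fin.cons (k v.2) (fun i => f (i, v.2)) : Fin (ℓ + 1) → ℕ) v.1, by simp⟩
    · rintro ⟨f, rfl⟩
      exact ⟨_, ⟨fun j => f (0, j), rfl⟩, _, ⟨fun v => f (v.1.succ, v.2), rfl⟩, rfl⟩

lemma expWord_mem {ℓ n : ℕ} (α : Fin ℓ × Fin n → ℕ) : expWord α ∈ letterBlock n ^ ℓ :=
  (mem_letterBlock_pow ℓ _).2 ⟨α, rfl⟩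

lemma nil_mem_letterBlock_pow (n ℓ : ℕ) : [] ∈ letterBlock n ^ ℓ :=
  (mem_letterBlock_pow ℓ _).2 ⟨0, by
    rw [expWord_eq_runWord, eq_comm]
    simp [runWord]⟩

lemma append_mem_letterBlock_pow {n p q : ℕ} {u v : List (Fin n)} (hu : u ∈ letterBlock n ^ p)
    (hv : v ∈ letterBlock n ^ q) : u ++ v ∈ letterBlock n ^ (p + q) := by
  rw [pow_add]
  exact Language.append_mem_mul hu hv

lemma letterBlock_pow_mono {n p q : ℕ} (h : p ≤ q) {u : List (Fin n)}
    (hu : u ∈ letterBlock n ^ p) : u ∈ letterBlock n ^ q := by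
  obtain ⟨r, rfl⟩ := Nat.exists_eq_add_of_le h
  simpa using append_mem_letterBlock_pow hu (nil_mem_letterBlock_pow n r)

lemma flatten_ofFn_replicate_ite {n : ℕ} (a : Fin n) (k : ℕ) :
    (List.ofFn fun j : Fin n => List.replicate (if j = a then k else 0) j).flatten
      = List.replicate k a := by
  have key : ∀ l : List (Fin n), l.Nodup → (l.map fun j =>
      List.replicate (if j = a then k else 0) j).flatten
        = if a ∈ l then List.replicate k a else [] := by
    intro l hl
    induction l with
    | nil => rfl
    | cons b l ih =>
      rw [List.nodup_cons] at hl
      by_cases hb : b = a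
      · subst hb
        simp [ih hl.2, hl.1]
      · simp [ih hl.2, hb, Ne.symm hb]
  rw [List.ofFn_eq_map, key _ (List.nodup_finRange n)]
  simp

lemma replicate_mem_letterBlock {n : ℕ} (a : Fin n) (k : ℕ) :
    List.replicate k a ∈ letterBlock n ^ 1 := by
  rw [pow_one, letterBlock]
  exact (mem_prod_kstar_letter (fun j => j) _).2
    ⟨fun j => if j = a then k else 0, (flatten_ofFn_replicate_ite a k).symm⟩

lemma altBounded_natCast (n k : ℕ) : altBounded n (k : ℕ∞) = letterBlock n ^ k := by
  ext w
  constructor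
  · intro h
    exact h k rfl
  · intro h m hm
    rwa [← Nat.cast_inj.1 hm]

/-! ### The subword relation between words given by runs -/

section sublist

variable {κ : Type*}

lemma replicate_append_sublist_replicate_append_of_le (a : κ) {p q z : ℕ} (h : p + z = q)
    (u v : List κ) :
    (List.replicate p a ++ u).Sublist (List.replicate q a ++ v) ↔
      u.Sublist (List.replicate z a ++ v) := by
  rw [← h, List.replicate_add, List.append_assoc, List.append_sublist_append_left]

lemma cons_sublist_replicate_append_of_ne {a b : κ} (hab : a ≠ b) (q : ℕ) (u v : List κ) :
    (a :: u).Sublist (List.replicate q b ++ v) ↔ (a :: u).Sublist v := by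
  induction q with
  | zero => simp
  | succ q ih =>
    rw [List.replicate_succ, List.cons_append, ← ih]
    constructor
    · intro h
      rcases List.sublist_cons_iff.1 h with h | ⟨r, hr, -⟩
      · exact h
      · exact absurd (List.cons_eq_cons.1 hr).1 hab
    · exact fun h => h.cons _

lemma replicate_append_sublist_replicate_append_of_ge (a : κ) {p q z : ℕ} (h : q + z = p)
    (u v : List κ) :
    (List.replicate p a ++ u).Sublist (List.replicate q a ++ v) ↔
      (List.replicate z a ++ u).Sublist v := by
  rw [← h, List.replicate_add, List.append_assoc, List.append_sublist_append_left]

end sublist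

/-- The numbers of occurrences of the letters, together with the subwords `a^i b^j` for distinct
letters `a` and `b`, determine a word. -/
lemma eq_of_count_eq_of_replicate_append_sublist {κ : Type*} [DecidableEq κ] {v w : List κ}
    (hc : ∀ a, v.count a = w.count a)
    (hs : ∀ a b, a ≠ b → ∀ i j, (List.replicate i a ++ List.replicate j b).Sublist v →
      (List.replicate i a ++ List.replicate j b).Sublist w) : v = w := by
  induction v generalizing w with
  | nil =>
    symm
    rw [List.eq_nil_iff_forall_not_mem]
    intro a ha
    have := hc a
    have := List.count_pos_iff.2 ha
    simp_all
  | cons a v ih =>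
    rcases w with - | ⟨c, w⟩
    · simpa using hc a
    obtain rfl : c = a := by
      by_contra hca
      -- `v` contains `a` followed by all its `c`, but `w` starts with one of these `c`.
      have h1 := hs a c (Ne.symm hca) 1 ((a :: v).count c) (by
        rw [List.count_cons_of_ne (Ne.symm hca)]
        exact (List.replicate_sublist_iff.2 le_rfl).cons_cons a)
      have h2 : (List.replicate ((a :: v).count c) c).Sublist w := by
        rcases List.sublist_cons_iff.1 h1 with h | ⟨r, hr, -⟩
        · exact (List.sublist_append_right _ _).trans h
        · exact absurd (List.cons_eq_cons.1 hr).1 (Ne.symm hca)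
      rw [List.replicate_sublist_iff, hc c, List.count_cons_self] at h2
      omega
    congr 1
    refine ih (fun b => ?_) fun a b hab i j h => ?_
    · have := hc b
      rw [List.count_cons, List.count_cons] at this
      omega
    · by_cases hac : a = c
      · subst hac
        have := hs a b hab (i + 1) j (h.cons_cons a)
        exact List.cons_sublist_cons.1 this
      · rcases i with - | i
        · simp only [List.replicate_zero, List.nil_append, List.replicate_sublist_iff] at h ⊢
          have := hc b
          rw [List.count_cons, List.count_cons] at this
          omega
        · have := hs a b hab (i + 1) j (h.cons c)
          rcases List.sublist_cons_iff.1 this with h | ⟨r, hr, -⟩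
          · exact h
          · exact absurd (List.cons_eq_cons.1 hr).1 hac

/-- An occurrence of `a^i b^j` as a subword of a word given by runs can be cut between two runs. -/
lemma exists_cut_of_replicate_append_sublist {Y κ : Type*} [DecidableEq κ] (R : List (Y × κ))
    (e : Y × κ → ℕ) {a b : κ} (hab : a ≠ b) (i j : ℕ)
    (h : (List.replicate i a ++ List.replicate j b).Sublist (runWord R e)) :
    ∃ t ≤ R.length, i ≤ (runWord (R.take t) e).count a ∧ j ≤ (runWord (R.drop t) e).count b := by
  induction R generalizing i with
  | nil =>
    have := List.sublist_nil.1 h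
    exact ⟨0, by simp, by simp_all⟩
  | cons v R ih =>
    rcases i with - | i
    · exact ⟨0, by simp, by simp, List.replicate_sublist_iff.1 (by simpa using h)⟩
    rw [runWord_cons] at h
    by_cases hv : v.2 = a
    · rw [hv] at h
      have h' : (List.replicate (i + 1 - e v) a ++ List.replicate j b).Sublist (runWord R e) := by
        rcases le_total (e v) (i + 1) with hle | hle
        · exact (replicate_append_sublist_replicate_append_of_ge a (by omega) _ _).1 h
        · rw [Nat.sub_eq_zero_of_le hle]
          have h := (replicate_append_sublist_replicate_append_of_le a
            (z := e v - (i + 1)) (by omega) _ _).1 h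
          rcases j with - | j
          · simp
          · exact (cons_sublist_replicate_append_of_ne (Ne.symm hab) _ _ _).1 h
      obtain ⟨t, ht, h1, h2⟩ := ih _ h'
      refine ⟨t + 1, by simpa using ht, ?_, by simpa using h2⟩
      simp only [List.take_succ_cons, runWord_cons, List.count_append, hv,
        List.count_replicate_self]
      omega
    · have h' := (cons_sublist_replicate_append_of_ne (Ne.symm hv) _ _ _).1 h
      obtain ⟨t, ht, h1, h2⟩ := ih (i + 1) h'
      refine ⟨t + 1, by simpa using ht, ?_, by simpa using h2⟩
      simp only [List.take_succ_cons, runWord_cons, List.count_append]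
      omega

/-- A word equals a given word `v` with few runs as soon as the numbers of occurrences of the
letters agree and it contains `a^i b^j` whenever `v` has a cut between two runs with `i` letters `a`
before and `j` letters `b` after it. -/
lemma eq_runWord_iff {Y κ : Type*} [DecidableEq κ] (R : List (Y × κ)) (e : Y × κ → ℕ)
    (w : List κ) :
    w = runWord R e ↔ (∀ a, w.count a = (runWord R e).count a) ∧
      ∀ a b, a ≠ b → ∀ t : Fin (R.length + 1),
        (List.replicate ((runWord (R.take t) e).count a) a ++
          List.replicate ((runWord (R.drop t) e).count b) b).Sublist w := by
  constructor
  · rintro rfl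
    refine ⟨fun _ => rfl, fun a b _ t => ?_⟩
    conv_rhs => rw [← List.take_append_drop t R]
    rw [runWord_append]
    exact (List.replicate_sublist_iff.2 le_rfl).append (List.replicate_sublist_iff.2 le_rfl)
  · rintro ⟨hc, hs⟩
    symm
    refine eq_of_count_eq_of_replicate_append_sublist (fun a => (hc a).symm) fun a b hab i j h => ?_
    obtain ⟨t, ht, h1, h2⟩ := exists_cut_of_replicate_append_sublist R e hab i j h
    refine List.Sublist.trans ?_ (hs a b hab ⟨t, by omega⟩)
    exact ((List.replicate_sublist_replicate a).2 h1).append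
      ((List.replicate_sublist_replicate b).2 h2)

/-! ### Letterwise semilinear sets -/

/-- The finite unions of boxes `{e | ∀ j, e(·, j) ∈ T j}` where each `T j` is semilinear: the sets
that restrict the exponents of different letters independently of each other. -/
inductive IsLetterwise {Y κ : Type*} : Set (Y × κ → ℕ) → Prop
  | empty : IsLetterwise ∅
  | box (T : κ → Set (Y → ℕ)) (hT : ∀ j, IsSemilinearSet (T j)) :
      IsLetterwise {e | ∀ j, (fun y => e (y, j)) ∈ T j}
  | union {S S' : Set (Y × κ → ℕ)} (h : IsLetterwise S) (h' : IsLetterwise S') :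
      IsLetterwise (S ∪ S')

namespace IsLetterwise

variable {X Y κ : Type*}

lemma iUnion_finset {ι : Type*} (s : Finset ι) {S : ι → Set (Y × κ → ℕ)}
    (h : ∀ i ∈ s, IsLetterwise (S i)) : IsLetterwise (⋃ i ∈ s, S i) := by
  classical
  induction s using Finset.induction_on with
  | empty => simpa using IsLetterwise.empty
  | insert i s _ ih =>
    rw [Finset.set_biUnion_insert]
    exact (h i (by simp)).union (ih fun j hj => h j (by simp [hj]))

lemma univ [Finite Y] : IsLetterwise (Set.univ : Set (Y × κ → ℕ)) := by
  convert IsLetterwise.box (Y := Y) (κ := κ) (fun _ => Set.univ) fun _ => IsSemilinearSet.univ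
  simp

lemma inter {S S' : Set (Y × κ → ℕ)} (h : IsLetterwise S) (h' : IsLetterwise S') :
    IsLetterwise (S ∩ S') := by
  induction h with
  | empty => simpa using IsLetterwise.empty
  | union _ _ ih ih' =>
    rw [Set.union_inter_distrib_right]
    exact ih.union ih'
  | box T hT =>
    induction h' with
    | empty => simpa using IsLetterwise.empty
    | union _ _ ih ih' =>
      rw [Set.inter_union_distrib_left]
      exact ih.union ih'
    | box T' hT' =>
      convert IsLetterwise.box (fun j => T j ∩ T' j) fun j => (hT j).inter (hT' j)
      ext e
      simp [forall_and]

/-- A single semilinear condition on the exponents of one letter. -/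
lemma of_letter [Finite Y] (j : κ) {T : Set (Y → ℕ)} (hT : IsSemilinearSet T) :
    IsLetterwise {e : Y × κ → ℕ | (fun y => e (y, j)) ∈ T} := by
  classical
  convert IsLetterwise.box (fun i => if i = j then T else Set.univ) fun i => by
    split_ifs
    exacts [hT, .univ]
  rename_i e
  constructor
  · intro h i
    split_ifs with hi
    · subst hi; exact h
    · trivial
  · intro h
    simpa using h j

lemma compl [Finite Y] [Finite κ] {S : Set (Y × κ → ℕ)} (h : IsLetterwise S) :
    IsLetterwise Sᶜ := by
  induction h with
  | empty => simpa using IsLetterwise.univ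
  | union _ _ ih ih' =>
    rw [Set.compl_union]
    exact ih.inter ih'
  | box T hT =>
    have := Fintype.ofFinite κ
    convert iUnion_finset (Finset.univ : Finset κ) fun j _ => of_letter j (hT j).compl
    ext e
    simp

lemma diff [Finite Y] [Finite κ] {S S' : Set (Y × κ → ℕ)} (h : IsLetterwise S)
    (h' : IsLetterwise S') : IsLetterwise (S \ S') :=
  h.inter h'.compl

lemma iInter [Finite Y] {ι : Type*} [Finite ι] {S : ι → Set (Y × κ → ℕ)}
    (h : ∀ i, IsLetterwise (S i)) : IsLetterwise (⋂ i, S i) := by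
  classical
  have := Fintype.ofFinite ι
  have key : ∀ s : Finset ι, IsLetterwise (⋂ i ∈ s, S i) := by
    intro s
    induction s using Finset.induction_on with
    | empty => simpa using IsLetterwise.univ
    | insert i s _ ih =>
      rw [Finset.set_biInter_insert]
      exact (h i).inter ih
  simpa using key Finset.univ

/-- Renaming of the runs, for each letter in the same way. -/
def reindex (κ : Type*) (g : X → Y) (e : Y × κ → ℕ) : X × κ → ℕ := fun v => e (g v.1, v.2)

lemma preimage_reindex [Finite Y] (g : X → Y) {S : Set (X × κ → ℕ)} (h : IsLetterwise S) :
    IsLetterwise (reindex κ g ⁻¹' S) := by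
  induction h with
  | empty => simpa using IsLetterwise.empty
  | union _ _ ih ih' => exact ih.union ih'
  | box T hT =>
    exact IsLetterwise.box (fun j => LinearMap.funLeft ℕ ℕ g ⁻¹' T j) fun j => (hT j).preimage _

lemma image_reindex (g : X → Y) {S : Set (Y × κ → ℕ)} (h : IsLetterwise S) :
    IsLetterwise (reindex κ g '' S) := by
  induction h with
  | empty => simpa using IsLetterwise.empty
  | union _ _ ih ih' =>
    rw [Set.image_union]
    exact ih.union ih'
  | box T hT =>
    convert IsLetterwise.box (fun j => LinearMap.funLeft ℕ ℕ g '' T j) fun j => (hT j).image _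
    ext e
    constructor
    · rintro ⟨e', h, rfl⟩ j
      exact ⟨_, h j, rfl⟩
    · intro h
      choose t ht hte using h
      refine ⟨fun v => t v.2 v.1, ht, ?_⟩
      ext ⟨x, j⟩
      exact congrFun (hte j) x

/-- Existential quantification over the exponents in the runs outside the range of `g`. -/
lemma saturate [Finite Y] (g : X → Y) {S : Set (Y × κ → ℕ)} (h : IsLetterwise S) :
    IsLetterwise {e | ∃ e' ∈ S, ∀ x j, e' (g x, j) = e (g x, j)} := by
  convert (h.image_reindex g).preimage_reindex g
  ext e
  refine exists_congr fun e' => and_congr_right fun _ => ?_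
  rw [funext_iff, Prod.forall]
  rfl

end IsLetterwise

/-! ### Letterwise semilinear sets have compatible representations -/

lemma IsPCompatible.empty {V κ : Type*} (P : κ → Set V) :
    IsPCompatible P (∅ : Set (V → ℕ)) :=
  ⟨∅, by simp, by simp⟩

lemma IsPCompatible.union {V κ : Type*} {P : κ → Set V} {S S' : Set (V → ℕ)}
    (h : IsPCompatible P S) (h' : IsPCompatible P S') : IsPCompatible P (S ∪ S') := by
  classical
  obtain ⟨R, hR, rfl⟩ := h
  obtain ⟨R', hR', rfl⟩ := h'
  refine ⟨R ∪ R', fun r hr => ?_, ?_⟩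
  · rcases Finset.mem_union.1 hr with hr | hr
    exacts [hR r hr, hR' r hr]
  · rw [Finset.set_biUnion_union]

lemma IsPCompatible.add {V κ : Type*} {P : κ → Set V} {S S' : Set (V → ℕ)}
    (h : IsPCompatible P S) (h' : IsPCompatible P S') : IsPCompatible P (S + S') := by
  classical
  obtain ⟨R, hR, rfl⟩ := h
  obtain ⟨R', hR', rfl⟩ := h'
  refine ⟨(R ×ˢ R').image fun r => (r.1.1 + r.2.1, r.1.2 ∪ r.2.2), fun r hr p hp => ?_, ?_⟩
  · obtain ⟨s, hs, rfl⟩ := Finset.mem_image.1 hr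
    rw [Finset.mem_product] at hs
    rcases Finset.mem_union.1 hp with hp | hp
    exacts [hR _ hs.1 p hp, hR' _ hs.2 p hp]
  · rw [Finset.set_biUnion_finset_image]
    simp only [Finset.coe_union, AddSubmonoid.closure_union, AddSubmonoid.coe_sup,
      ← vadd_add_vadd]
    ext x
    simp only [Set.mem_add, Set.mem_iUnion, Finset.mem_product, exists_prop, Prod.exists]
    constructor
    · rintro ⟨y, ⟨r, F, hr, hy⟩, z, ⟨r', F', hr', hz⟩, rfl⟩
      exact ⟨_, _, ⟨_, _, ⟨hr, hr'⟩, y, hy, z, hz, rfl⟩⟩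
    · rintro ⟨r, F, r', F', ⟨hr, hr'⟩, y, hy, z, hz, rfl⟩
      exact ⟨y, ⟨r, F, hr, hy⟩, z, ⟨r', F', hr', hz⟩, rfl⟩

lemma IsPCompatible.zero {V κ : Type*} (P : κ → Set V) :
    IsPCompatible P (0 : Set (V → ℕ)) :=
  ⟨{(0, ∅)}, by simp, by simp [Set.singleton_zero]⟩

lemma IsPCompatible.sum {V κ ι : Type*} {P : κ → Set V} (s : Finset ι)
    {S : ι → Set (V → ℕ)} (h : ∀ i ∈ s, IsPCompatible P (S i)) :
    IsPCompatible P (∑ i ∈ s, S i) :=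
  Finset.sum_induction S (IsPCompatible P) (fun _ _ => IsPCompatible.add) (.zero P) h

/-- A semilinear set of vectors that all vanish outside one block is compatible. -/
lemma IsPCompatible.image_of_isSemilinearSet {V M κ : Type*} [AddCommMonoid M]
    {P : κ → Set V} (i : κ) (f : M →+ (V → ℕ)) (hf : ∀ m, ∀ v ∉ P i, f m v = 0)
    {T : Set M} (hT : IsSemilinearSet T) : IsPCompatible P (f '' T) := by
  classical
  obtain ⟨C, hC, rfl⟩ := isSemilinearSet_iff.1 hT
  induction C using Finset.induction_on with
  | empty => simpa using IsPCompatible.empty P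
  | insert L C _ ih =>
    rw [Finset.coe_insert, Set.sUnion_insert, Set.image_union]
    have hC' : ∀ t ∈ C, IsLinearSet t := fun t ht => hC t (by simp [ht])
    refine .union ?_ (ih hC' (isSemilinearSet_iff.2 ⟨C, hC', rfl⟩))
    obtain ⟨b, F, hL⟩ := isLinearSet_iff.1 (hC L (by simp))
    refine ⟨{(f b, F.image f)}, fun r hr p hp => ?_, ?_⟩
    · obtain rfl := Finset.mem_singleton.1 hr
      obtain ⟨m, -, rfl⟩ := Finset.mem_image.1 hp
      exact ⟨i, hf m⟩
    · simp [hL, Set.image_vadd_distrib, ← AddMonoidHom.map_mclosure]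

lemma IsLetterwise.isPCompatible {Y κ : Type*} [Finite κ] {S : Set (Y × κ → ℕ)}
    (h : IsLetterwise S) :
    IsPCompatible (fun j : κ => {x : Y × κ | x.2 = j}) S := by
  classical
  have := Fintype.ofFinite κ
  induction h with
  | empty => exact .empty _
  | union _ _ ih ih' => exact ih.union ih'
  | box T hT =>
    let f (j : κ) : (Y → ℕ) →+ (Y × κ → ℕ) :=
      { toFun := fun t v => if v.2 = j then t v.1 else 0
        map_zero' := by ext; simp
        map_add' := fun s t => by
          ext v
          by_cases h : v.2 = j <;> simp [h] }
    -- A box is the sum of its projections to the coordinates of the single letters.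
    convert IsPCompatible.sum (Finset.univ : Finset κ) fun j _ =>
      IsPCompatible.image_of_isSemilinearSet (P := fun j : κ => {x : Y × κ | x.2 = j}) j (f j)
        (fun t v hv => if_neg hv) (hT j)
    ext e
    rw [Set.mem_finsetSum]
    constructor
    · intro h
      refine ⟨fun j => f j fun y => e (y, j), fun {j} _ => ⟨_, h j, rfl⟩, ?_⟩
      ext ⟨y, j⟩
      simp [f, Finset.sum_apply]
    · rintro ⟨g, hg, rfl⟩ j
      have hg' : ∀ i, ∃ t ∈ T i, f i t = g i := fun i => hg (Finset.mem_univ i)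
      choose t ht htg using hg'
      convert ht j using 1
      ext y
      simp [← htg, f, Finset.sum_apply]

lemma IsPCompatible.isSemilinearSet {V κ : Type*} {P : κ → Set V} {S : Set (V → ℕ)}
    (h : IsPCompatible P S) : IsSemilinearSet S := by
  obtain ⟨R, -, rfl⟩ := h
  exact .biUnion_finset fun r _ => IsLinearSet.isSemilinearSet ⟨r.1, _, r.2.finite_toSet, rfl⟩

/-! ### The subword relation is letterwise semilinear -/

section coordinates

variable {Y : Type*} [Finite Y]

lemma isSemilinearSet_eq_const (y : Y) (k : ℕ) : IsSemilinearSet {t : Y → ℕ | t y = k} := by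
  simpa using isSemilinearSet_setOfPred_eq (M := Y → ℕ) 0 k
    (Pi.evalAddMonoidHom (fun _ : Y => ℕ) y) (0 : (Y → ℕ) →+ ℕ)

lemma isSemilinearSet_add_eq (p z q : Y) : IsSemilinearSet {t : Y → ℕ | t p + t z = t q} := by
  simpa using isSemilinearSet_setOfPred_eq (M := Y → ℕ) 0 0
    (Pi.evalAddMonoidHom (fun _ : Y => ℕ) p + Pi.evalAddMonoidHom (fun _ : Y => ℕ) z)
    (Pi.evalAddMonoidHom (fun _ : Y => ℕ) q)

variable {κ : Type*}

lemma isLetterwise_eq_const (v : Y × κ) (k : ℕ) : IsLetterwise {e : Y × κ → ℕ | e v = k} :=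
  IsLetterwise.of_letter v.2 (isSemilinearSet_eq_const v.1 k)

end coordinates

lemma runWord_reindex {X Y κ : Type*} (g : X → Y) (R : List (X × κ)) (e : Y × κ → ℕ) :
    runWord (R.map (Prod.map g id)) e = runWord R (IsLetterwise.reindex κ g e) :=
  runWord_map g R e

/-- The exponents of pairs of words, with prescribed letters of their runs, such that the first word
is a subword of the second. The first runs are compared; when their letters agree, the difference
of the exponents is guessed as the exponent of a new run. -/
theorem isLetterwise_runWord_sublist {κ : Type*} [Finite κ] {Y : Type} [Finite Y]
    (R R' : List (Y × κ)) :
    IsLetterwise {e : Y × κ → ℕ | (runWord R e).Sublist (runWord R' e)} := by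
  classical
  induction hN : R.length + R'.length using Nat.strong_induction_on generalizing Y R R' with
  | _ N ih =>
  rcases R with - | ⟨⟨y, a⟩, R⟩
  · simpa using IsLetterwise.univ
  have hskip : IsLetterwise {e : Y × κ → ℕ | e (y, a) = 0 ∧ (runWord R e).Sublist (runWord R' e)} :=
    (isLetterwise_eq_const _ _).inter (ih _ (by simp at hN; omega) R R' rfl)
  rcases R' with - | ⟨⟨y', b⟩, R'⟩
  · convert hskip using 1
    ext e
    simp
  by_cases hab : a = b
  · subst hab
    let up := List.map (Prod.map (some : Y → Option Y) (id : κ → κ))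
    have hle := ih (R.length + (((none, a) : Option Y × κ) :: up R').length)
      (by simp [up] at hN ⊢; omega) (up R) ((none, a) :: up R') (by simp [up])
    have hge := ih ((((none, a) : Option Y × κ) :: up R).length + R'.length)
      (by simp [up] at hN ⊢; omega) ((none, a) :: up R) (up R') (by simp [up])
    have hle' := ((IsLetterwise.of_letter a
      (isSemilinearSet_add_eq (some y) none (some y'))).inter hle).image_reindex some
    have hge' := ((IsLetterwise.of_letter a
      (isSemilinearSet_add_eq (some y') none (some y))).inter hge).image_reindex some
    convert hle'.union hge' using 1
    ext e
    simp only [Set.mem_ofPred_eq, runWord_cons, Set.mem_union, Set.mem_image, Set.mem_inter_iff,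
      up, runWord_reindex]
    constructor
    · intro h
      rcases le_total (e (y, a)) (e (y', a)) with hc | hc
      · obtain ⟨z, hz⟩ := Nat.exists_eq_add_of_le hc
        rw [replicate_append_sublist_replicate_append_of_le a hz.symm] at h
        exact .inl ⟨fun v => v.1.elim z fun x => e (x, v.2), ⟨hz.symm, h⟩, rfl⟩
      · obtain ⟨z, hz⟩ := Nat.exists_eq_add_of_le hc
        rw [replicate_append_sublist_replicate_append_of_ge a hz.symm] at h
        exact .inr ⟨fun v => v.1.elim z fun x => e (x, v.2), ⟨hz.symm, h⟩, rfl⟩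
    · rintro (⟨e', ⟨hz, h⟩, rfl⟩ | ⟨e', ⟨hz, h⟩, rfl⟩)
      · exact (replicate_append_sublist_replicate_append_of_le a hz _ _).2 h
      · exact (replicate_append_sublist_replicate_append_of_ge a hz _ _).2 h
  · have hdrop := (isLetterwise_eq_const (y, a) 0).compl.inter
      (ih _ (by simp at hN ⊢; omega) ((y, a) :: R) R' rfl)
    convert hskip.union hdrop using 1
    ext e
    rcases Nat.eq_zero_or_pos (e (y, a)) with h0 | h0
    · simp [h0]
    · obtain ⟨k, hk⟩ : ∃ k, e (y, a) = k + 1 := ⟨e (y, a) - 1, by omega⟩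
      simp only [Set.mem_ofPred_eq, runWord_cons, Set.mem_union, Set.mem_inter_iff,
        Set.mem_compl_iff, hk, List.replicate_succ, List.cons_append]
      rw [cons_sublist_replicate_append_of_ne hab]
      simp

/-! ### Languages definable with alternation bounds have letterwise semilinear exponents -/

/-- All variables of a formula, free or quantified. -/
def Formula.vars {n : ℕ} : Formula n → Finset ℕ
  | .eq s t => s.vars ∪ t.vars
  | .subword s t => s.vars ∪ t.vars
  | .not φ => φ.vars
  | .and φ ψ => φ.vars ∪ ψ.vars
  | .or φ ψ => φ.vars ∪ ψ.vars
  | .ex x φ => insert x φ.vars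
  | .all x φ => insert x φ.vars

lemma Term.val_congr {n : ℕ} {α α' : ℕ → List (Fin n)} (s : Term n)
    (h : ∀ x ∈ s.vars, α x = α' x) : s.val α = s.val α' := by
  cases s with
  | var x => exact h x (by simp [Term.vars])
  | const w => rfl

lemma Formula.holds_congr {n : ℕ} (b : ℕ → ℕ∞) (φ : Formula n) {α α' : ℕ → List (Fin n)}
    (h : ∀ x ∈ φ.freeVars, α x = α' x) : φ.Holds b α ↔ φ.Holds b α' := by
  induction φ generalizing α α' with
  | eq s t | subword s t =>
    simp only [Formula.freeVars, Finset.mem_union] at h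
    simp only [Formula.Holds, s.val_congr fun x hx => h x (.inl hx),
      t.val_congr fun x hx => h x (.inr hx)]
  | not φ ih => exact not_congr (ih h)
  | and φ ψ ih ih' =>
    simp only [Formula.freeVars, Finset.mem_union] at h
    exact and_congr (ih fun x hx => h x (.inl hx)) (ih' fun x hx => h x (.inr hx))
  | or φ ψ ih ih' =>
    simp only [Formula.freeVars, Finset.mem_union] at h
    exact or_congr (ih fun x hx => h x (.inl hx)) (ih' fun x hx => h x (.inr hx))
  | ex x φ ih | all x φ ih =>
    have key : ∀ w, φ.Holds b (Function.update α x w) ↔ φ.Holds b (Function.update α' x w) := by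
      refine fun w => ih fun y hy => ?_
      by_cases hyx : y = x
      · subst hyx; simp
      · simpa [hyx] using h y (Finset.mem_erase.2 ⟨hyx, hy⟩)
    simp only [Formula.Holds, key]

/-- The runs of the values of the variables below `N`, when the variable `x` takes its values in
`(a_1^* ⋯ a_n^*)^(β x)`, and one additional run (`none`) of exponent `1` for the letters of the
constants. -/
abbrev Slot (β : ℕ → ℕ) (N : ℕ) : Type := Option (Σ x : Fin N, Fin (β x))

section assignments

variable {n N : ℕ} {β : ℕ → ℕ}

/-- The runs of the value of the variable `x`. -/
def slotRuns (n : ℕ) {N : ℕ} {β : ℕ → ℕ} (x : Fin N) : List (Slot β N × Fin n) :=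
  (allRuns (β x) n).map (Prod.map (fun i => some ⟨x, i⟩) id)

/-- The assignment with given exponents; the variables from `N` on get the empty word. -/
def slotAssignment (e : Slot β N × Fin n → ℕ) (x : ℕ) : List (Fin n) :=
  if h : x < N then runWord (slotRuns n (⟨x, h⟩ : Fin N)) e else []

/-- The exponent vectors that have exponent `1` in the run for the letters of constants. -/
def unitSlot (n N : ℕ) (β : ℕ → ℕ) : Set (Slot β N × Fin n → ℕ) :=
  {e | ∀ j, e (none, j) = 1}

lemma isLetterwise_unitSlot : IsLetterwise (unitSlot n N β) := by
  have : unitSlot n N β = ⋂ j : Fin n, {e | e (none, j) = 1} := by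
    ext e; simp [unitSlot]
  rw [this]
  exact .iInter fun j => isLetterwise_eq_const _ _

lemma slotAssignment_of_lt (e : Slot β N × Fin n → ℕ) (x : Fin N) :
    slotAssignment e x = expWord fun v : Fin (β x) × Fin n => e (some ⟨x, v.1⟩, v.2) := by
  rw [slotAssignment, dif_pos x.2, slotRuns, expWord_eq_runWord]
  exact runWord_map _ _ _

lemma slotAssignment_mem (e : Slot β N × Fin n → ℕ) (x : Fin N) :
    slotAssignment e x ∈ letterBlock n ^ β x := by
  rw [slotAssignment_of_lt]
  exact expWord_mem _

/-- The exponents of the value of a single variable can be changed so that it becomes any word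
within its bound. -/
lemma exists_slotAssignment_eq_update (e : Slot β N × Fin n → ℕ) (x : Fin N) {w : List (Fin n)}
    (hw : w ∈ letterBlock n ^ β x) :
    ∃ e' : Slot β N × Fin n → ℕ,
      (∀ s : {s : Slot β N // ∀ i, s ≠ some ⟨x, i⟩}, ∀ j, e' (s.1, j) = e (s.1, j)) ∧
      slotAssignment e' = Function.update (slotAssignment e) x w := by
  obtain ⟨α, rfl⟩ := (mem_letterBlock_pow _ _).1 hw
  refine ⟨fun v => match v with
    | (none, j) => e (none, j)
    | (some ⟨y, i⟩, j) => if h : y = x then α (Fin.cast (by rw [h]) i, j) else e (some ⟨y, i⟩, j),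
    ?_, ?_⟩
  · rintro ⟨_ | ⟨y, i⟩, hs⟩ j
    · rfl
    · refine dif_neg fun h => ?_
      subst h
      exact hs i rfl
  · funext y
    by_cases hy : y < N
    · obtain ⟨y, rfl⟩ : ∃ z : Fin N, (z : ℕ) = y := ⟨⟨y, hy⟩, rfl⟩
      rw [slotAssignment_of_lt]
      by_cases hyx : y = x
      · subst hyx
        simp
      · have : (y : ℕ) ≠ x := fun h => hyx (Fin.ext h)
        simp [hyx, this, slotAssignment_of_lt]
    · have : y ≠ x := fun h => hy (h ▸ x.2)
      simp [slotAssignment, hy, this]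

lemma slotAssignment_eq_update {e e' : Slot β N × Fin n → ℕ} {x : Fin N}
    (h : ∀ s : {s : Slot β N // ∀ i, s ≠ some ⟨x, i⟩}, ∀ j, e' (s.1, j) = e (s.1, j)) :
    slotAssignment e' = Function.update (slotAssignment e) x (slotAssignment e' x) := by
  funext y
  by_cases hyx : y = x
  · subst hyx; simp
  rw [Function.update_of_ne hyx]
  by_cases hy : y < N
  · obtain ⟨y, rfl⟩ : ∃ z : Fin N, (z : ℕ) = y := ⟨⟨y, hy⟩, rfl⟩
    rw [slotAssignment_of_lt, slotAssignment_of_lt]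
    congr 1
    funext v
    refine h ⟨some ⟨y, v.1⟩, fun i hi => hyx ?_⟩ v.2
    rw [Option.some_inj, Sigma.mk.injEq] at hi
    rw [hi.1]
  · simp [slotAssignment, hy]

lemma exists_runWord_eq_val (s : Term n) (hs : ∀ x ∈ s.vars, x < N) :
    ∃ R : List (Slot β N × Fin n), ∀ e ∈ unitSlot n N β,
      runWord R e = s.val (slotAssignment e) := by
  cases s with
  | var x =>
    have hx := hs x (by simp [Term.vars])
    exact ⟨slotRuns n ⟨x, hx⟩, fun e _ => by simp [Term.val, slotAssignment, hx]⟩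
  | const w =>
    exact ⟨w.map fun j => (none, j), fun e he => runWord_eq_self_of_eq_one none w e he⟩

lemma isLetterwise_holds_of_isQF (b : ℕ → ℕ∞) {φ : Formula n} (hφ : φ.IsQF)
    (hN : ∀ x ∈ φ.vars, x < N) :
    IsLetterwise {e ∈ unitSlot n N β | φ.Holds b (slotAssignment e)} := by
  induction φ with
  | eq s t =>
    simp only [Formula.vars, Finset.mem_union] at hN
    obtain ⟨R, hR⟩ := exists_runWord_eq_val (β := β) s fun x hx => hN x (.inl hx)
    obtain ⟨R', hR'⟩ := exists_runWord_eq_val (β := β) t fun x hx => hN x (.inr hx)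
    convert isLetterwise_unitSlot.inter
      ((isLetterwise_runWord_sublist R R').inter (isLetterwise_runWord_sublist R' R)) using 1
    ext e
    refine and_congr_right fun he => ?_
    simp only [Set.mem_inter_iff, Set.mem_ofPred_eq, hR e he, hR' e he, Formula.Holds]
    exact ⟨fun h => h ▸ ⟨.refl _, .refl _⟩, fun h => h.1.antisymm h.2⟩
  | subword s t =>
    simp only [Formula.vars, Finset.mem_union] at hN
    obtain ⟨R, hR⟩ := exists_runWord_eq_val (β := β) s fun x hx => hN x (.inl hx)
    obtain ⟨R', hR'⟩ := exists_runWord_eq_val (β := β) t fun x hx => hN x (.inr hx)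
    convert isLetterwise_unitSlot.inter (isLetterwise_runWord_sublist R R') using 1
    ext e
    refine and_congr_right fun he => ?_
    simp only [Set.mem_ofPred_eq, hR e he, hR' e he, Formula.Holds]
  | not φ ih =>
    convert isLetterwise_unitSlot.diff (ih hφ hN) using 1
    ext e
    refine and_congr_right fun he => ?_
    simp [he, Formula.Holds]
  | and φ ψ ih ih' =>
    simp only [Formula.vars, Finset.mem_union] at hN
    convert (ih hφ.1 fun x hx => hN x (.inl hx)).inter (ih' hφ.2 fun x hx => hN x (.inr hx)) using 1
    ext e
    simp only [Formula.Holds, Set.mem_inter_iff, Set.mem_ofPred_eq]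
    tauto
  | or φ ψ ih ih' =>
    simp only [Formula.vars, Finset.mem_union] at hN
    convert (ih hφ.1 fun x hx => hN x (.inl hx)).union (ih' hφ.2 fun x hx => hN x (.inr hx)) using 1
    ext e
    simp only [Formula.Holds, Set.mem_union, Set.mem_ofPred_eq]
    tauto
  | ex x φ _ => exact hφ.elim
  | all x φ _ => exact hφ.elim

lemma isLetterwise_holds_of_isSigmaOne {φ : Formula n} (hφ : φ.IsSigmaOne)
    (hN : ∀ x ∈ φ.vars, x < N) :
    IsLetterwise {e ∈ unitSlot n N β | φ.Holds (fun x => (β x : ℕ∞)) (slotAssignment e)} := by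
  induction hφ with
  | qf h => exact isLetterwise_holds_of_isQF _ h hN
  | ex x hφ ih =>
    simp only [Formula.vars, Finset.mem_insert] at hN
    obtain ⟨x, rfl⟩ : ∃ z : Fin N, (z : ℕ) = x := ⟨⟨x, hN x (.inl rfl)⟩, rfl⟩
    convert (ih fun y hy => hN y (.inr hy)).saturate
      (fun s : {s : Slot β N // ∀ i, s ≠ some ⟨x, i⟩} => s.1) using 1
    ext e
    simp only [Formula.Holds, altBounded_natCast, Set.mem_ofPred_eq]
    constructor
    · rintro ⟨he, w, hw, h⟩
      obtain ⟨e', he', heq⟩ := exists_slotAssignment_eq_update e x hw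
      exact ⟨e', ⟨fun j => (he' ⟨none, by simp⟩ j).trans (he j), heq ▸ h⟩, fun s j => he' s j⟩
    · rintro ⟨e', ⟨he', h⟩, hag⟩
      refine ⟨fun j => (hag ⟨none, by simp⟩ j).symm.trans (he' j), slotAssignment e' x,
        slotAssignment_mem e' x, ?_⟩
      rwa [← slotAssignment_eq_update hag]

end assignments

theorem isPCompatible_exponents_of_definable {n : ℕ} {L : Language (Fin n)}
    (hL : DefinableSigmaOne 0 L) (ℓ : ℕ) :
    IsPCompatible (letterPartition ℓ n) (exponents ℓ L) := by
  obtain ⟨⟨φ, b⟩, x, ⟨hφ, hb⟩, hx, rfl⟩ := hL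
  obtain ⟨β, rfl⟩ : ∃ β : ℕ → ℕ, b = fun x => (β x : ℕ∞) := by
    have hfin : ∀ y, b y ≠ ⊤ := by
      intro y hy
      have : {x : ℕ | b x = ⊤} = ∅ := by simpa using hb
      exact (Set.ext_iff.1 this y).1 hy
    exact ⟨fun y => (b y).toNat, funext fun y => (ENat.natCast_toNat (hfin y)).symm⟩
  obtain ⟨N, hN⟩ : ∃ N, ∀ y ∈ insert x φ.vars, y < N :=
    ⟨(insert x φ.vars).sup id + 1, fun y hy => Nat.lt_succ_of_le (Finset.le_sup (f := id) hy)⟩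
  obtain ⟨x, rfl⟩ : ∃ z : Fin N, (z : ℕ) = x := ⟨⟨x, hN x (by simp)⟩, rfl⟩
  have hS := isLetterwise_holds_of_isSigmaOne (β := β) hφ fun y hy => hN y (by simp [hy])
  simp only at hx
  let up : Slot β N → Slot β N ⊕ Fin ℓ := Sum.inl
  let R : List ((Slot β N ⊕ Fin ℓ) × Fin n) := (slotRuns n x).map (Prod.map up id)
  let R' : List ((Slot β N ⊕ Fin ℓ) × Fin n) := (allRuns ℓ n).map (Prod.map Sum.inr id)
  refine IsLetterwise.isPCompatible (κ := Fin n) (Y := Fin ℓ) ?_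
  convert ((hS.preimage_reindex up).inter ((isLetterwise_runWord_sublist R R').inter
    (isLetterwise_runWord_sublist R' R))).image_reindex (Sum.inr : Fin ℓ → Slot β N ⊕ Fin ℓ) using 1
  have hval : ∀ e : Slot β N × Fin n → ℕ, runWord (slotRuns n x) e = slotAssignment e x :=
    fun e => by simp [slotAssignment]
  ext γ
  simp only [Set.mem_image, Set.mem_inter_iff, Set.mem_preimage, Set.mem_ofPred_eq, R, R',
    runWord_reindex, hval]
  constructor
  · rintro ⟨α, ⟨hα, hmem⟩, hαγ⟩
    replace hmem := hmem x (by simp [hx])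
    simp only [altBounded_natCast] at hmem
    obtain ⟨e, he, heq⟩ := exists_slotAssignment_eq_update (β := β) (fun _ => 1) x hmem
    have hex : slotAssignment e x = α x := by simp [heq]
    refine ⟨fun v => v.1.elim (fun s => e (s, v.2)) fun i => γ (i, v.2), ⟨⟨?_, ?_⟩, ?_⟩, rfl⟩
    · exact fun j => he ⟨none, by simp⟩ j
    · refine (φ.holds_congr _ fun y hy => ?_).1 hα
      obtain rfl : y = x := by simpa [hx] using hy
      exact hex.symm
    · have h1 : slotAssignment e x = runWord (allRuns ℓ n) γ := by
        rw [hex, hαγ, expWord_eq_runWord]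
      exact ⟨(h1 ▸ .refl _ : (slotAssignment e x).Sublist (runWord (allRuns ℓ n) γ)),
        (h1 ▸ .refl _ : (runWord (allRuns ℓ n) γ).Sublist (slotAssignment e x))⟩
  · rintro ⟨e, ⟨⟨he, hh⟩, h1, h2⟩, rfl⟩
    refine ⟨slotAssignment (IsLetterwise.reindex (Fin n) up e), ⟨hh, fun y hy => ?_⟩, ?_⟩
    · obtain rfl : y = x := by simpa [hx] using hy
      simp only [altBounded_natCast]
      exact slotAssignment_mem _ x
    · rw [expWord_eq_runWord]
      exact h1.antisymm h2

/-! ### Relations definable by existential formulas -/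

/-- Relations on words definable by quantifier-free formulas; the index type `ι` names the
variables. -/
inductive QFDef {n : ℕ} {ι : Type} : ((ι → List (Fin n)) → Prop) → Prop
  | sub (s t : ι ⊕ List (Fin n)) : QFDef fun α => (Sum.elim α id s).Sublist (Sum.elim α id t)
  | not {Q : (ι → List (Fin n)) → Prop} (h : QFDef Q) : QFDef fun α => ¬ Q α
  | and {Q Q' : (ι → List (Fin n)) → Prop} (h : QFDef Q) (h' : QFDef Q') :
      QFDef fun α => Q α ∧ Q' α
  | or {Q Q' : (ι → List (Fin n)) → Prop} (h : QFDef Q) (h' : QFDef Q') :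
      QFDef fun α => Q α ∨ Q' α

/-- Relations on words definable by a block of existential quantifiers, all of them restricted to
`(a_1^* ⋯ a_n^*)^B`, in front of a quantifier-free formula. -/
def EDef {n : ℕ} (B : ℕ) {ι : Type} (R : (ι → List (Fin n)) → Prop) : Prop :=
  ∃ (κ : Type) (_ : Finite κ) (Q : (ι ⊕ κ → List (Fin n)) → Prop), QFDef Q ∧
    ∀ α, R α ↔ ∃ β : κ → List (Fin n), (∀ i, β i ∈ letterBlock n ^ B) ∧ Q (Sum.elim α β)

section closure

variable {n B : ℕ} {ι ι' : Type}

lemma QFDef.reindex {Q : (ι → List (Fin n)) → Prop} (h : QFDef Q) (g : ι → ι') :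
    QFDef fun α : ι' → List (Fin n) => Q fun i => α (g i) := by
  induction h with
  | sub s t =>
    convert QFDef.sub (Sum.map g id s) (Sum.map g id t) using 2
    rcases s with s | s <;> rcases t with t | t <;> rfl
  | not _ ih => exact ih.not
  | and _ _ ih ih' => exact ih.and ih'
  | or _ _ ih ih' => exact ih.or ih'

lemma QFDef.eDef {Q : (ι → List (Fin n)) → Prop} (h : QFDef Q) : EDef B Q :=
  ⟨Empty, inferInstance, _, h.reindex Sum.inl, fun _ =>
    ⟨fun h => ⟨Empty.elim, fun i => i.elim, h⟩, fun ⟨_, _, h⟩ => h⟩⟩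

namespace EDef

lemma congr {R R' : (ι → List (Fin n)) → Prop} (h : EDef B R) (hR : ∀ α, R' α ↔ R α) :
    EDef B R' := by
  rwa [show R' = R from funext fun α => propext (hR α)]

lemma sub (s t : ι ⊕ List (Fin n)) :
    EDef B fun α => (Sum.elim α id s).Sublist (Sum.elim α id t) :=
  (QFDef.sub s t).eDef

lemma nsub (s t : ι ⊕ List (Fin n)) :
    EDef B fun α => ¬ (Sum.elim α id s).Sublist (Sum.elim α id t) :=
  (QFDef.sub s t).not.eDef

lemma reindex {R : (ι → List (Fin n)) → Prop} (h : EDef B R) (g : ι → ι') :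
    EDef B fun α : ι' → List (Fin n) => R fun i => α (g i) := by
  obtain ⟨κ, _, Q, hQ, hR⟩ := h
  refine ⟨κ, inferInstance, _, hQ.reindex (Sum.map g id), fun α => (hR _).trans ?_⟩
  refine exists_congr fun β => and_congr_right fun _ => ?_
  rw [iff_iff_eq]
  congr 1
  ext (i | i) <;> rfl

lemma and {R R' : (ι → List (Fin n)) → Prop} (h : EDef B R) (h' : EDef B R') :
    EDef B fun α => R α ∧ R' α := by
  obtain ⟨κ, _, Q, hQ, hR⟩ := h
  obtain ⟨κ', _, Q', hQ', hR'⟩ := h'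
  refine ⟨κ ⊕ κ', inferInstance, _, (hQ.reindex (Sum.map id Sum.inl)).and
    (hQ'.reindex (Sum.map id Sum.inr)), fun α => (and_congr (hR α) (hR' α)).trans ?_⟩
  constructor
  · rintro ⟨⟨β, hβ, h⟩, β', hβ', h'⟩
    refine ⟨Sum.elim β β', fun i => i.casesOn hβ hβ', ?_, ?_⟩
    · convert h using 1; ext (i | i) <;> rfl
    · convert h' using 1; ext (i | i) <;> rfl
  · rintro ⟨β, hβ, h, h'⟩
    refine ⟨⟨fun i => β (.inl i), fun i => hβ _, ?_⟩, fun i => β (.inr i), fun i => hβ _, ?_⟩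
    · convert h using 1; ext (i | i) <;> rfl
    · convert h' using 1; ext (i | i) <;> rfl

lemma or {R R' : (ι → List (Fin n)) → Prop} (h : EDef B R) (h' : EDef B R') :
    EDef B fun α => R α ∨ R' α := by
  obtain ⟨κ, _, Q, hQ, hR⟩ := h
  obtain ⟨κ', _, Q', hQ', hR'⟩ := h'
  have hnil := nil_mem_letterBlock_pow n B
  refine ⟨κ ⊕ κ', inferInstance, _, (hQ.reindex (Sum.map id Sum.inl)).or
    (hQ'.reindex (Sum.map id Sum.inr)), fun α => (or_congr (hR α) (hR' α)).trans ?_⟩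
  constructor
  · rintro (⟨β, hβ, h⟩ | ⟨β, hβ, h⟩)
    · refine ⟨Sum.elim β fun _ => [], fun i => i.casesOn hβ fun _ => hnil, .inl ?_⟩
      convert h using 1; ext (i | i) <;> rfl
    · refine ⟨Sum.elim (fun _ => []) β, fun i => i.casesOn (fun _ => hnil) hβ, .inr ?_⟩
      convert h using 1; ext (i | i) <;> rfl
  · rintro ⟨β, hβ, h | h⟩
    · refine .inl ⟨fun i => β (.inl i), fun i => hβ _, ?_⟩
      convert h using 1; ext (i | i) <;> rfl
    · refine .inr ⟨fun i => β (.inr i), fun i => hβ _, ?_⟩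
      convert h using 1; ext (i | i) <;> rfl

lemma const (p : Prop) : EDef (n := n) (ι := ι) B fun _ => p := by
  by_cases hp : p
  · exact (sub (.inr []) (.inr [])).congr fun _ => by simp [hp]
  · exact (nsub (.inr []) (.inr [])).congr fun _ => by simp [hp]

lemma imp_const {p : Prop} {R : (ι → List (Fin n)) → Prop} (h : p → EDef B R) :
    EDef B fun α => p → R α := by
  by_cases hp : p
  · exact (h hp).congr fun _ => by simp [hp]
  · exact (const True).congr fun _ => by simp [hp]

lemma forall_finite {I : Type*} [Finite I] {R : I → (ι → List (Fin n)) → Prop}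
    (h : ∀ i, EDef B (R i)) : EDef B fun α => ∀ i, R i α := by
  classical
  have := Fintype.ofFinite I
  have key : ∀ s : Finset I, EDef B fun α => ∀ i ∈ s, R i α := by
    intro s
    induction s using Finset.induction_on with
    | empty => exact (const True).congr fun _ => by simp
    | insert i s _ ih => exact ((h i).and ih).congr fun _ => by simp
  exact (key Finset.univ).congr fun _ => by simp

lemma exists_mem_finset {I : Type*} (s : Finset I) {R : I → (ι → List (Fin n)) → Prop}
    (h : ∀ i ∈ s, EDef B (R i)) : EDef B fun α => ∃ i ∈ s, R i α := by
  classical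
  induction s using Finset.induction_on with
  | empty => exact (const False).congr fun _ => by simp
  | insert i s _ ih =>
    exact ((h i (by simp)).or (ih fun j hj => h j (by simp [hj]))).congr fun _ => by simp

/-- Existential quantification over finitely many words, provided that all witnesses respect the
bound. -/
lemma exists_family {F : Type} [Finite F] {R : (ι → List (Fin n)) → (F → List (Fin n)) → Prop}
    (h : EDef B fun α : ι ⊕ F → List (Fin n) => R (fun i => α (.inl i)) fun i => α (.inr i))
    (hb : ∀ α β, R α β → ∀ i, β i ∈ letterBlock n ^ B) :
    EDef B fun α => ∃ β, R α β := by
  obtain ⟨κ, _, Q, hQ, hR⟩ := h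
  refine ⟨F ⊕ κ, inferInstance, _, hQ.reindex (Equiv.sumAssoc ι F κ), fun α => ?_⟩
  constructor
  · rintro ⟨β, h⟩
    obtain ⟨γ, hγ, h'⟩ := (hR (Sum.elim α β)).1 h
    refine ⟨Sum.elim β γ, fun i => i.casesOn (hb α β h) hγ, ?_⟩
    convert h' using 1; ext ((i | i) | i) <;> rfl
  · rintro ⟨β, hβ, h⟩
    refine ⟨fun i => β (.inl i), (hR (Sum.elim α fun i => β (.inl i))).2
      ⟨fun i => β (.inr i), fun i => hβ _, ?_⟩⟩
    convert h using 1; ext ((i | i) | i) <;> rfl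

/-- Existential quantification over one word; `none` is the new variable. -/
lemma ex {R : (ι → List (Fin n)) → List (Fin n) → Prop}
    (h : EDef B fun α : Option ι → List (Fin n) => R (fun i => α (some i)) (α none))
    (hb : ∀ α w, R α w → w ∈ letterBlock n ^ B) : EDef B fun α => ∃ w, R α w := by
  have h' := h.reindex fun i : Option ι => (i.elim (.inr ()) .inl : ι ⊕ Unit)
  refine (exists_family (F := Unit) (R := fun α β => R α (β ())) h'
    fun α β hβ _ => hb α _ hβ).congr fun α => ?_
  exact ⟨fun ⟨w, hw⟩ => ⟨fun _ => w, hw⟩, fun ⟨β, hβ⟩ => ⟨β (), hβ⟩⟩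

end EDef

end closure

/-! ### From definable relations to formulas -/

lemma QFDef.exists_formula {n : ℕ} {ι : Type} {Q : (ι → List (Fin n)) → Prop} (h : QFDef Q)
    (f : ι → ℕ) : ∃ φ : Formula n, φ.IsQF ∧ (∀ x ∈ φ.freeVars, ∃ i, f i = x) ∧
      ∀ b α, φ.Holds b α ↔ Q fun i => α (f i) := by
  induction h with
  | sub s t =>
    let term : ι ⊕ List (Fin n) → Term n := Sum.elim (fun i => .var (f i)) .const
    have hval : ∀ s α, (term s).val α = Sum.elim (fun i => α (f i)) id s := by
      rintro (s | s) α <;> rfl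
    have hvars : ∀ s, ∀ x ∈ (term s).vars, ∃ i, f i = x := by
      rintro (s | s) x hx
      · exact ⟨s, (Finset.mem_singleton.1 hx).symm⟩
      · simp [term, Term.vars] at hx
    refine ⟨.subword (term s) (term t), trivial, fun x hx => ?_, fun b α => ?_⟩
    · rcases Finset.mem_union.1 hx with hx | hx
      exacts [hvars s x hx, hvars t x hx]
    · simp only [Formula.Holds, hval]
  | not _ ih =>
    obtain ⟨φ, h1, h2, h3⟩ := ih
    exact ⟨.not φ, h1, h2, fun b α => not_congr (h3 b α)⟩
  | and _ _ ih ih' =>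
    obtain ⟨φ, h1, h2, h3⟩ := ih
    obtain ⟨ψ, h1', h2', h3'⟩ := ih'
    exact ⟨.and φ ψ, ⟨h1, h1'⟩, fun x hx => (Finset.mem_union.1 hx).elim (h2 x) (h2' x),
      fun b α => and_congr (h3 b α) (h3' b α)⟩
  | or _ _ ih ih' =>
    obtain ⟨φ, h1, h2, h3⟩ := ih
    obtain ⟨ψ, h1', h2', h3'⟩ := ih'
    exact ⟨.or φ ψ, ⟨h1, h1'⟩, fun x hx => (Finset.mem_union.1 hx).elim (h2 x) (h2' x),
      fun b α => or_congr (h3 b α) (h3' b α)⟩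

/-- Existential quantification over the variables `1, …, k`. -/
def Formula.exs {n : ℕ} : ℕ → Formula n → Formula n
  | 0, φ => φ
  | k + 1, φ => exs k (.ex (k + 1) φ)

lemma Formula.isSigmaOne_exs {n : ℕ} (k : ℕ) {φ : Formula n} (h : φ.IsSigmaOne) :
    (φ.exs k).IsSigmaOne := by
  induction k generalizing φ with
  | zero => exact h
  | succ k ih => exact ih (.ex _ h)

lemma Formula.mem_freeVars_exs {n : ℕ} (k : ℕ) (φ : Formula n) (x : ℕ) :
    x ∈ (φ.exs k).freeVars ↔ x ∈ φ.freeVars ∧ ¬ (1 ≤ x ∧ x ≤ k) := by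
  induction k generalizing φ with
  | zero =>
    simp only [exs, iff_self_and]
    omega
  | succ k ih =>
    simp only [exs, ih, freeVars, Finset.mem_erase, and_comm (a := x ≠ _), and_assoc]
    refine and_congr_right fun _ => ?_
    omega

lemma Formula.holds_exs {n : ℕ} (b : ℕ → ℕ∞) (k : ℕ) (φ : Formula n) (α : ℕ → List (Fin n)) :
    (φ.exs k).Holds b α ↔ ∃ α', (∀ x, 1 ≤ x → x ≤ k → α' x ∈ altBounded n (b x)) ∧
      (∀ x, ¬ (1 ≤ x ∧ x ≤ k) → α' x = α x) ∧ φ.Holds b α' := by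
  induction k generalizing φ with
  | zero =>
    constructor
    · exact fun h => ⟨α, fun x _ _ => by omega, fun _ _ => rfl, h⟩
    · rintro ⟨α', -, h, h'⟩
      rwa [← show α' = α from funext fun x => h x (by omega)]
  | succ k ih =>
    simp only [exs, ih, Holds]
    constructor
    · rintro ⟨α', h1, h2, w, hw, h⟩
      refine ⟨_, fun x hx hxk => ?_, fun x hx => ?_, h⟩
      · by_cases hxk' : x = k + 1
        · subst hxk'; simpa using hw
        · simpa [hxk'] using h1 x hx (by omega)
      · rw [Function.update_of_ne (by omega)]
        exact h2 x (by omega)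
    · rintro ⟨α', h1, h2, h⟩
      refine ⟨Function.update α' (k + 1) (α (k + 1)), fun x hx hxk => ?_, fun x hx => ?_,
        α' (k + 1), h1 _ (by omega) le_rfl, by simpa using h⟩
      · rw [Function.update_of_ne (by omega)]
        exact h1 x hx (by omega)
      · by_cases hxk : x = k + 1
        · subst hxk; simp
        · rw [Function.update_of_ne hxk]
          exact h2 x (by omega)

lemma EDef.definableSigmaOne {n B : ℕ} {L : Language (Fin n)}
    (h : EDef B fun α : Unit → List (Fin n) => α () ∈ L) (hL : L ≤ letterBlock n ^ B) :
    DefinableSigmaOne 0 L := by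
  obtain ⟨κ, _, Q, hQ, hR⟩ := h
  obtain ⟨k, ⟨c⟩⟩ := Finite.exists_equiv_fin κ
  let f : Unit ⊕ κ → ℕ := Sum.elim (fun _ => 0) fun i => c i + 1
  obtain ⟨φ, hqf, hfree, hφ⟩ := hQ.exists_formula f
  let b : ℕ → ℕ∞ := fun _ => (B : ℕ∞)
  -- The conjunct `x = x` makes sure that the variable `x = 0` occurs in the formula.
  let ψ : Formula n := .and (.eq (.var 0) (.var 0)) φ
  have hholds : ∀ α : ℕ → List (Fin n), (ψ.exs k).Holds b α ↔ α 0 ∈ L := by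
    intro α
    refine (Formula.holds_exs b k ψ α).trans (.trans ?_ (hR fun _ => α 0).symm)
    constructor
    · rintro ⟨α', h1, h2, -, h⟩
      refine ⟨fun i => α' (c i + 1), fun i => ?_, ?_⟩
      · rw [← altBounded_natCast]
        exact h1 _ (by omega) (by omega)
      · rw [hφ] at h
        convert h using 1
        ext (i | i)
        · simp [f, h2 0 (by omega)]
        · simp [f]
    · rintro ⟨β, hβ, h⟩
      refine ⟨fun x => if hx : 1 ≤ x ∧ x ≤ k then β (c.symm ⟨x - 1, by omega⟩) else α x,
        fun x hx hxk => ?_, fun x hx => by simp [hx], rfl, ?_⟩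
      · simp only [hx, hxk, and_self, dite_true, b, altBounded_natCast]
        exact hβ _
      · rw [hφ]
        convert h using 1
        ext (i | i)
        · simp [f]
        · simp [f]
  have hvars : (ψ.exs k).freeVars = {0} := by
    ext x
    rw [Formula.mem_freeVars_exs, Finset.mem_singleton]
    constructor
    · rintro ⟨hx, hxk⟩
      rcases Finset.mem_union.1 hx with hx | hx
      · simpa [Formula.freeVars, Term.vars] using hx
      · obtain ⟨i | i, rfl⟩ := hfree x hx
        · rfl
        · exact absurd ⟨by simp [f], (c i).2⟩ hxk
    · rintro rfl
      simp [ψ, Formula.freeVars, Term.vars]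
  refine ⟨⟨ψ.exs k, b⟩, 0, ⟨Formula.isSigmaOne_exs k (.qf ⟨trivial, hqf⟩), ?_⟩, hvars, ?_⟩
  · simp [b]
  · ext w
    constructor
    · refine fun hw => ⟨fun _ => w, ⟨(hholds _).2 hw, fun x _ => ?_⟩, rfl⟩
      change w ∈ altBounded n (B : ℕ∞)
      rw [altBounded_natCast]
      exact hL hw
    · rintro ⟨α, ⟨hα, -⟩, rfl⟩
      exact (hholds α).1 hα

/-! ### Words with one marked position -/

section marked

variable {κ : Type*}

/-- The word `a^p b a^q`. -/
def marked (a b : κ) (p q : ℕ) : List κ := List.replicate p a ++ b :: List.replicate q a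

lemma marked_sublist_marked {a b : κ} (hab : a ≠ b) {p q p' q' : ℕ} :
    (marked a b p q).Sublist (marked a b p' q') ↔ p ≤ p' ∧ q ≤ q' := by
  unfold marked
  rcases le_or_gt p p' with h | h
  · obtain ⟨z, rfl⟩ := Nat.exists_eq_add_of_le h
    rw [replicate_append_sublist_replicate_append_of_le a rfl,
      cons_sublist_replicate_append_of_ne hab.symm, List.cons_sublist_cons,
      List.replicate_sublist_replicate]
    simp
  · obtain ⟨z, rfl⟩ := Nat.exists_eq_add_of_lt h
    rw [add_assoc, replicate_append_sublist_replicate_append_of_ge a rfl]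
    refine iff_of_false (fun hs => ?_) (by omega)
    have h2 := (cons_sublist_replicate_append_of_ne (q := 1) hab _ _).1 hs
    have : b ∈ List.replicate q' a := h2.subset (by simp)
    exact hab (List.eq_of_mem_replicate this).symm

lemma count_marked [DecidableEq κ] {a b : κ} (hab : a ≠ b) (p q : ℕ) :
    (marked a b p q).count a = p + q := by
  simp [marked, hab.symm]

lemma replicate_sublist_marked {a b : κ} (hab : a ≠ b) {m p q : ℕ} :
    (List.replicate m a).Sublist (marked a b p q) ↔ m ≤ p + q := by
  classical
  rw [List.replicate_sublist_iff, count_marked hab]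

lemma marked_mem {n B : ℕ} (hB : 3 ≤ B) (a b : Fin n) (p q : ℕ) :
    marked a b p q ∈ letterBlock n ^ B :=
  letterBlock_pow_mono hB (append_mem_letterBlock_pow (p := 1) (replicate_mem_letterBlock a p)
    (append_mem_letterBlock_pow (p := 1) (q := 1) (u := [b]) (replicate_mem_letterBlock b 1)
      (replicate_mem_letterBlock a q)))

lemma replicate_mem {n B : ℕ} (hB : 3 ≤ B) (a : Fin n) (k : ℕ) :
    List.replicate k a ∈ letterBlock n ^ B :=
  letterBlock_pow_mono (by omega) (replicate_mem_letterBlock a k)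

lemma exists_eq_replicate_iff {a : κ} {w : List κ} :
    (∃ k, w = List.replicate k a) ↔ ∀ c, c ≠ a → ¬ [c].Sublist w := by
  simp only [List.singleton_sublist]
  constructor
  · rintro ⟨k, rfl⟩ c hc h
    exact hc (List.eq_of_mem_replicate h)
  · refine fun h => ⟨w.length, List.eq_replicate_of_mem fun c hc => ?_⟩
    by_contra hca
    exact h c hca hc

lemma exists_eq_marked_iff {a b : κ} (hab : a ≠ b) {w : List κ} :
    (∃ p q, w = marked a b p q) ↔
      (∀ c, c ≠ a ∧ c ≠ b → ¬ [c].Sublist w) ∧ [b].Sublist w ∧ ¬ [b, b].Sublist w := by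
  classical
  have hbb : [b, b].Sublist w ↔ 2 ≤ w.count b := List.replicate_sublist_iff (n := 2)
  simp only [List.singleton_sublist, hbb]
  constructor
  · rintro ⟨p, q, rfl⟩
    refine ⟨fun c hc h => ?_, by simp [marked], ?_⟩
    · simp [marked, List.mem_replicate, hc] at h
    · simp [marked, hab, List.count_replicate]
  · rintro ⟨h1, h2, h3⟩
    obtain ⟨s, t, rfl⟩ := List.append_of_mem h2
    rw [List.count_append, List.count_cons_self] at h3
    have hs : ∀ c ∈ s, c = a := by
      intro c hc
      by_contra hca
      by_cases hcb : c = b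
      · subst hcb
        have := List.count_pos_iff.2 hc
        omega
      · exact h1 c ⟨hca, hcb⟩ (by simp [hc])
    have ht : ∀ c ∈ t, c = a := by
      intro c hc
      by_contra hca
      by_cases hcb : c = b
      · subst hcb
        have := List.count_pos_iff.2 hc
        omega
      · exact h1 c ⟨hca, hcb⟩ (by simp [hc])
    exact ⟨s.length, t.length, by
      rw [marked, ← List.eq_replicate_of_mem hs, ← List.eq_replicate_of_mem ht]⟩

/-- The words in `a^* b^*`. -/
lemma eq_replicate_append_replicate_iff [DecidableEq κ] {a b : κ} (hab : a ≠ b) {w : List κ} :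
    w = List.replicate (w.count a) a ++ List.replicate (w.count b) b ↔
      (∀ c, c ≠ a ∧ c ≠ b → ¬ [c].Sublist w) ∧ ¬ [b, a].Sublist w := by
  constructor
  · intro h
    rw [h]
    refine ⟨fun c hc hs => ?_, fun hs => ?_⟩
    · have := hs.subset (List.mem_singleton_self c)
      simp [List.mem_replicate, hc] at this
    · have h2 := (cons_sublist_replicate_append_of_ne hab.symm _ _ _).1 hs
      have : a ∈ List.replicate (w.count b) b := h2.subset (by simp)
      exact hab (List.eq_of_mem_replicate this)
  · rintro ⟨h1, h2⟩
    induction w with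
    | nil => rfl
    | cons c w ih =>
      have ih := ih (fun d hd hs => h1 d hd (hs.cons c)) fun hs => h2 (hs.cons c)
      by_cases hca : c = a
      · subst hca
        rw [List.count_cons_self, List.count_cons_of_ne hab, List.replicate_succ,
          List.cons_append, ← ih]
      · obtain rfl : c = b := by
          by_contra hcb
          exact h1 c ⟨hca, hcb⟩ (by simp)
        have h0 : w.count a = 0 := by
          rw [List.count_eq_zero]
          exact fun ha => h2 ((List.singleton_sublist.2 ha).cons_cons c)
        rw [h0] at ih
        rw [List.count_cons_self, List.count_cons_of_ne hca, h0, List.replicate_succ,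
          List.replicate_zero, List.nil_append]
        rw [List.replicate_zero, List.nil_append] at ih
        rw [← ih]

end marked

/-! ### Definability of arithmetic on the exponents -/

namespace EDef

variable {n B : ℕ} {ι : Type}

lemma eq_const (i : ι) (w : List (Fin n)) : EDef B fun α : ι → List (Fin n) => α i = w :=
  ((sub (.inl i) (.inr w)).and (sub (.inr w) (.inl i))).congr fun _ =>
    ⟨fun h => h ▸ ⟨.refl _, .refl _⟩, fun h => h.1.antisymm h.2⟩

lemma isReplicate (i : ι) (a : Fin n) :
    EDef B fun α : ι → List (Fin n) => ∃ k, α i = List.replicate k a :=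
  (forall_finite fun c => imp_const fun _ : c ≠ a => nsub (.inr [c]) (.inl i)).congr
    fun _ => exists_eq_replicate_iff

lemma isMarked (i : ι) {a b : Fin n} (hab : a ≠ b) :
    EDef B fun α : ι → List (Fin n) => ∃ p q, α i = marked a b p q :=
  ((forall_finite fun c => imp_const fun _ : c ≠ a ∧ c ≠ b => nsub (.inr [c]) (.inl i)).and
    ((sub (.inr [b]) (.inl i)).and (nsub (.inr [b, b]) (.inl i)))).congr
    fun _ => exists_eq_marked_iff hab

lemma isMarked_left (i : ι) {a b : Fin n} (hab : a ≠ b) (p : ℕ) :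
    EDef B fun α : ι → List (Fin n) => ∃ q, α i = marked a b p q := by
  refine ((isMarked i hab).and ((sub (.inr (marked a b p 0)) (.inl i)).and
    (nsub (.inr (marked a b (p + 1) 0)) (.inl i)))).congr fun α => ?_
  constructor
  · rintro ⟨q, h⟩
    simp [h, marked_sublist_marked hab]
  · rintro ⟨⟨p', q, h⟩, h1, h2⟩
    simp only [Sum.elim_inl, Sum.elim_inr, id, h, marked_sublist_marked hab] at h1 h2
    exact ⟨q, by rw [h]; congr 1; omega⟩

/-- The successor on powers of `a`. The inequalities `r < s`, `t < r`, `s < s'` and `s' ≤ t + 3`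
force `s' = s + 1`, and with `x = a^s`, `x' = a^s'`, `y = b a^r` and `z = a^3 b a^t` each of them
is the presence or absence of a subword. For `s ≤ 1` there are no such `r` and `t`. -/
lemma succ (hB : 3 ≤ B) (i j : ι) {a b : Fin n} (hab : a ≠ b) :
    EDef B fun α : ι → List (Fin n) =>
      ∃ k, α i = List.replicate k a ∧ α j = List.replicate (k + 1) a := by
  have key : EDef B fun α : ι → List (Fin n) => ∃ y z, (∃ s, α i = List.replicate s a) ∧
      (∃ s, α j = List.replicate s a) ∧ (∃ r, y = marked a b 0 r) ∧ (∃ t, z = marked a b 3 t) ∧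
      ¬ (α i).Sublist y ∧ ¬ y.Sublist z ∧ (α j).Sublist z ∧ ¬ (α j).Sublist (α i) := by
    refine ex (ex ?_ ?_) ?_
    · exact (isReplicate (some (some i)) a).and <| (isReplicate (some (some j)) a).and <|
        (isMarked_left (some none) hab 0).and <| (isMarked_left none hab 3).and <|
        (nsub (.inl (some (some i))) (.inl (some none))).and <|
        (nsub (.inl (some none)) (.inl none)).and <|
        (sub (.inl (some (some j))) (.inl none)).and
        (nsub (.inl (some (some j))) (.inl (some (some i))))
    · rintro α z ⟨-, -, -, ⟨t, rfl⟩, -⟩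
      exact marked_mem hB _ _ _ _
    · rintro α y ⟨z, -, -, ⟨r, rfl⟩, -⟩
      exact marked_mem hB _ _ _ _
  refine ((((eq_const i []).and (eq_const j [a])).or
    ((eq_const i [a]).and (eq_const j [a, a]))).or key).congr fun α => ?_
  constructor
  · rintro ⟨s, hi, hj⟩
    rcases s with - | - | s
    · exact .inl (.inl ⟨hi, hj⟩)
    · exact .inl (.inr ⟨hi, hj⟩)
    · refine .inr ⟨marked a b 0 (s + 1), marked a b 3 s, ⟨_, hi⟩, ⟨_, hj⟩, ⟨_, rfl⟩, ⟨_, rfl⟩, ?_⟩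
      rw [hi, hj, replicate_sublist_marked hab, replicate_sublist_marked hab,
        marked_sublist_marked hab, List.replicate_sublist_replicate]
      omega
  · rintro ((⟨hi, hj⟩ | ⟨hi, hj⟩) | ⟨_, _, ⟨s, hi⟩, ⟨s', hj⟩, ⟨r, rfl⟩, ⟨t, rfl⟩, h⟩)
    · exact ⟨0, hi, hj⟩
    · exact ⟨1, hi, hj⟩
    · rw [hi, hj, replicate_sublist_marked hab, replicate_sublist_marked hab,
        marked_sublist_marked hab, List.replicate_sublist_replicate] at h
      exact ⟨s, hi, by rw [hj]; congr 1; omega⟩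

/-- Counting: `a^k` is the largest power of `a` that is a subword. -/
lemma eq_replicate_count (hB : 3 ≤ B) (i j : ι) {a b : Fin n} (hab : a ≠ b) :
    EDef B fun α : ι → List (Fin n) => α j = List.replicate ((α i).count a) a := by
  have key : EDef B fun α : ι → List (Fin n) => ∃ x,
      (∃ k, α j = List.replicate k a ∧ x = List.replicate (k + 1) a) ∧ (α j).Sublist (α i) ∧
        ¬ x.Sublist (α i) := by
    refine ex ?_ ?_
    · exact (succ hB (some j) none hab).and <| (sub (.inl (some j)) (.inl (some i))).and
        (nsub (.inl none) (.inl (some i)))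
    · rintro α x ⟨⟨k, -, rfl⟩, -⟩
      exact replicate_mem hB _ _
  refine key.congr fun α => ?_
  constructor
  · intro h
    refine ⟨_, ⟨_, h, rfl⟩, ?_⟩
    rw [h, List.replicate_sublist_iff, List.replicate_sublist_iff]
    omega
  · rintro ⟨_, ⟨k, h, rfl⟩, h1, h2⟩
    rw [h, List.replicate_sublist_iff] at h1
    rw [List.replicate_sublist_iff] at h2
    rw [h]
    congr 1
    omega

/-- Extraction of the number of letters `a` before (or after) the marker, from the comparison with
the words `a^k b` (or `b a^k`), abstractly given as `side k`. -/
lemma marked_side (hB : 3 ≤ B) (i u : ι) {a b : Fin n} (hab : a ≠ b) (side : ℕ → List (Fin n))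
    (f : ℕ → ℕ → ℕ) (hf : ∀ k p q, (side k).Sublist (marked a b p q) ↔ k ≤ f p q)
    (hside : ∀ k, ∃ p q, side k = marked a b p q) (hcount : ∀ k, (side k).count a = k)
    (hdef : ∀ {ι : Type} (v : ι), EDef B fun α : ι → List (Fin n) => ∃ k, α v = side k) :
    EDef B fun α : ι → List (Fin n) =>
      ∃ p q, α i = List.replicate (f p q) a ∧ α u = marked a b p q := by
  have key : EDef B fun α : ι → List (Fin n) => ∃ x v v',
      (∃ k, α i = List.replicate k a ∧ x = List.replicate (k + 1) a) ∧
      ((∃ k, v = side k) ∧ α i = List.replicate (v.count a) a) ∧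
      ((∃ k, v' = side k) ∧ x = List.replicate (v'.count a) a) ∧
      (∃ p q, α u = marked a b p q) ∧ v.Sublist (α u) ∧ ¬ v'.Sublist (α u) := by
    have hmem : ∀ k, side k ∈ letterBlock n ^ B := by
      intro k
      obtain ⟨p, q, h⟩ := hside k
      exact h ▸ marked_mem hB _ _ _ _
    refine ex (ex (ex ?_ ?_) ?_) ?_
    · exact (succ hB (some (some (some i))) (some (some none)) hab).and <|
        ((hdef (some none)).and
          (eq_replicate_count hB (some none) (some (some (some i))) hab)).and <|
        ((hdef none).and (eq_replicate_count hB none (some (some none)) hab)).and <|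
        (isMarked (some (some (some u))) hab).and <|
        (sub (.inl (some none)) (.inl (some (some (some u))))).and
        (nsub (.inl none) (.inl (some (some (some u)))))
    · rintro α v' ⟨-, -, ⟨⟨k, rfl⟩, -⟩, -⟩
      exact hmem k
    · rintro α v ⟨v', -, ⟨⟨k, rfl⟩, -⟩, -⟩
      exact hmem k
    · rintro α x ⟨v, v', ⟨k, -, rfl⟩, -⟩
      exact replicate_mem hB _ _
  refine key.congr fun α => ?_
  constructor
  · rintro ⟨p, q, hi, hu⟩
    refine ⟨_, side (f p q), side (f p q + 1), ⟨_, hi, rfl⟩, ⟨⟨_, rfl⟩, by rw [hi, hcount]⟩,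
      ⟨⟨_, rfl⟩, by rw [hcount]⟩, ⟨_, _, hu⟩, ?_⟩
    rw [hu, hf, hf]
    omega
  · rintro ⟨_, _, _, ⟨k, hi, rfl⟩, ⟨⟨k1, rfl⟩, h1⟩, ⟨⟨k2, rfl⟩, h2⟩, ⟨p, q, hu⟩, h⟩
    rw [hcount] at h1 h2
    rw [hi] at h1
    have h1 := List.replicate_left_injective a h1
    have h2 := List.replicate_left_injective a h2
    rw [hu, hf, hf] at h
    exact ⟨p, q, by rw [hi]; congr 1; omega, hu⟩

/-- Addition of exponents: `a^p b a^q` has `p + q` letters `a`. -/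
lemma add (hB : 3 ≤ B) (i j k : ι) {a b : Fin n} (hab : a ≠ b) :
    EDef B fun α : ι → List (Fin n) => ∃ p q, α i = List.replicate p a ∧
      α j = List.replicate q a ∧ α k = List.replicate (p + q) a := by
  have hleft : ∀ {ι : Type} (i u : ι), EDef B fun α : ι → List (Fin n) =>
      ∃ p q, α i = List.replicate p a ∧ α u = marked a b p q := by
    intro ι i u
    refine marked_side hB i u hab (fun k => marked a b k 0) (fun p _ => p) ?_ ?_ ?_ ?_
    · simp [marked_sublist_marked hab]
    · exact fun k => ⟨_, _, rfl⟩
    · simp [count_marked hab]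
    · intro ι v
      refine ((isMarked v hab).and (nsub (.inr (marked a b 0 1)) (.inl v))).congr fun α => ?_
      constructor
      · rintro ⟨k, h⟩
        simp [h, marked_sublist_marked hab]
      · rintro ⟨⟨p, q, h⟩, h1⟩
        simp only [Sum.elim_inl, Sum.elim_inr, id, h, marked_sublist_marked hab] at h1
        exact ⟨p, by rw [h]; congr 1; omega⟩
  have hright : ∀ {ι : Type} (i u : ι), EDef B fun α : ι → List (Fin n) =>
      ∃ p q, α i = List.replicate q a ∧ α u = marked a b p q := by
    intro ι i u
    refine marked_side hB i u hab (fun k => marked a b 0 k) (fun _ q => q) ?_ ?_ ?_ ?_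
    · simp [marked_sublist_marked hab]
    · exact fun k => ⟨_, _, rfl⟩
    · simp [count_marked hab]
    · exact fun v => isMarked_left v hab 0
  have key : EDef B fun α : ι → List (Fin n) => ∃ u,
      (∃ p q, α i = List.replicate p a ∧ u = marked a b p q) ∧
      (∃ p q, α j = List.replicate q a ∧ u = marked a b p q) ∧
      α k = List.replicate (u.count a) a := by
    refine ex ?_ ?_
    · exact (hleft (some i) none).and <| (hright (some j) none).and
        (eq_replicate_count hB none (some k) hab)
    · rintro α u ⟨⟨p, q, -, rfl⟩, -⟩
      exact marked_mem hB _ _ _ _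
  refine key.congr fun α => ?_
  constructor
  · rintro ⟨p, q, hi, hj, hk⟩
    exact ⟨marked a b p q, ⟨p, q, hi, rfl⟩, ⟨p, q, hj, rfl⟩, by rw [hk, count_marked hab]⟩
  · rintro ⟨_, ⟨p, q, hi, rfl⟩, ⟨p', q', hj, h⟩, hk⟩
    have h1 : p ≤ p' ∧ q ≤ q' := (marked_sublist_marked hab).1 (by simp [h])
    have h2 : p' ≤ p ∧ q' ≤ q := (marked_sublist_marked hab).1 (by simp [h])
    rw [count_marked hab] at hk
    exact ⟨p, q, hi, by rw [hj]; congr 1; omega, hk⟩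

end EDef

/-- The functions from tuples of words to numbers whose values, written as powers of `a`, are
definable. -/
def IsNatDef {n : ℕ} (B : ℕ) (a : Fin n) {ι : Type} (f : (ι → List (Fin n)) → ℕ) : Prop :=
  EDef B fun α : Option ι → List (Fin n) => α none = List.replicate (f fun i => α (some i)) a

namespace IsNatDef

variable {n B : ℕ} {ι : Type} {a b : Fin n}

lemma const (k : ℕ) : IsNatDef B a fun _ : ι → List (Fin n) => k :=
  EDef.eq_const none _

lemma count (hB : 3 ≤ B) (hab : a ≠ b) (i : ι) :
    IsNatDef B a fun α : ι → List (Fin n) => (α i).count a :=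
  EDef.eq_replicate_count hB (some i) none hab

lemma add (hB : 3 ≤ B) (hab : a ≠ b) {f g : (ι → List (Fin n)) → ℕ} (hf : IsNatDef B a f)
    (hg : IsNatDef B a g) : IsNatDef B a fun α => f α + g α := by
  have key : EDef B fun α : Option ι → List (Fin n) => ∃ x y,
      x = List.replicate (f fun i => α (some i)) a ∧
      y = List.replicate (g fun i => α (some i)) a ∧
      ∃ p q, x = List.replicate p a ∧ y = List.replicate q a ∧
        α none = List.replicate (p + q) a := by
    refine EDef.ex (EDef.ex ?_ ?_) ?_
    · exact (hf.reindex fun i : Option ι =>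
        (i.elim (some none) fun i => some (some (some i)) : Option (Option (Option ι)))).and <|
        (hg.reindex fun i : Option ι =>
          (i.elim none fun i => some (some (some i)) : Option (Option (Option ι)))).and <|
        EDef.add hB (some none) none (some (some none)) hab
    · rintro α y ⟨-, rfl, -⟩
      exact replicate_mem hB _ _
    · rintro α x ⟨y, rfl, -⟩
      exact replicate_mem hB _ _
  refine key.congr fun α => ?_
  constructor
  · exact fun h => ⟨_, _, rfl, rfl, _, _, rfl, rfl, h⟩
  · rintro ⟨_, _, rfl, rfl, p, q, h1, h2, h⟩
    beta_reduce
    rw [h, List.replicate_left_injective a h1, List.replicate_left_injective a h2]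

lemma mul_const (hB : 3 ≤ B) (hab : a ≠ b) {f : (ι → List (Fin n)) → ℕ} (hf : IsNatDef B a f)
    (k : ℕ) : IsNatDef B a fun α => f α * k := by
  induction k with
  | zero => exact const 0
  | succ k ih => exact ih.add hB hab hf

lemma finset_sum (hB : 3 ≤ B) (hab : a ≠ b) {I : Type*} (s : Finset I)
    {f : I → (ι → List (Fin n)) → ℕ} (hf : ∀ i ∈ s, IsNatDef B a (f i)) :
    IsNatDef B a fun α => ∑ i ∈ s, f i α := by
  classical
  induction s using Finset.induction_on with
  | empty => simpa using const 0
  | insert i s hi ih =>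
    simp only [Finset.sum_insert hi]
    exact (hf i (by simp)).add hB hab (ih fun j hj => hf j (by simp [hj]))

lemma list_sum (hB : 3 ≤ B) (hab : a ≠ b) {I : Type*} (l : List I)
    {f : I → (ι → List (Fin n)) → ℕ} (hf : ∀ i ∈ l, IsNatDef B a (f i)) :
    IsNatDef B a fun α => (l.map fun i => f i α).sum := by
  induction l with
  | nil => exact const 0
  | cons i l ih => exact (hf i (by simp)).add hB hab (ih fun j hj => hf j (by simp [hj]))

lemma count_eq (hB : 3 ≤ B) (hab : a ≠ b) {f : (ι → List (Fin n)) → ℕ} (hf : IsNatDef B a f)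
    (i : ι) : EDef B fun α => (α i).count a = f α := by
  have key : EDef B fun α : ι → List (Fin n) => ∃ x, x = List.replicate (f α) a ∧
      x = List.replicate ((α i).count a) a := by
    refine EDef.ex (hf.and (EDef.eq_replicate_count hB (some i) none hab)) ?_
    rintro α x ⟨rfl, -⟩
    exact replicate_mem hB _ _
  refine key.congr fun α => ?_
  constructor
  · exact fun h => ⟨_, rfl, by rw [h]⟩
  · rintro ⟨_, rfl, h⟩
    exact (List.replicate_left_injective a h).symm

lemma replicate_append_sublist (hB : 3 ≤ B) (hab : a ≠ b) {f g : (ι → List (Fin n)) → ℕ}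
    (hf : IsNatDef B a f) (hg : IsNatDef B b g) (i : ι) :
    EDef B fun α => (List.replicate (f α) a ++ List.replicate (g α) b).Sublist (α i) := by
  have key : EDef B fun α : ι → List (Fin n) => ∃ v,
      ((∀ c, c ≠ a ∧ c ≠ b → ¬ [c].Sublist v) ∧ ¬ [b, a].Sublist v) ∧
      v.count a = f α ∧ v.count b = g α ∧ v.Sublist (α i) := by
    refine EDef.ex ?_ ?_
    · exact ((EDef.forall_finite fun c => EDef.imp_const fun _ : c ≠ a ∧ c ≠ b =>
        EDef.nsub (.inr [c]) (.inl none)).and (EDef.nsub (.inr [b, a]) (.inl none))).and <|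
        (count_eq hB hab (f := fun α : Option ι → List (Fin n) => f fun i => α (some i))
          (hf.reindex fun i : Option ι => i.elim none fun i => some (some i)) none).and <|
        (count_eq hB hab.symm (f := fun α : Option ι → List (Fin n) => g fun i => α (some i))
          (hg.reindex fun i : Option ι => i.elim none fun i => some (some i)) none).and
        (EDef.sub (.inl none) (.inl (some i)))
    · rintro α v ⟨hv, -⟩
      rw [(eq_replicate_append_replicate_iff hab).2 hv]
      exact letterBlock_pow_mono (p := 1 + 1) (by omega) (append_mem_letterBlock_pow
        (replicate_mem_letterBlock _ _) (replicate_mem_letterBlock _ _))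
  refine key.congr fun α => ?_
  constructor
  · intro h
    refine ⟨_, (eq_replicate_append_replicate_iff hab).1 ?_, ?_, ?_, h⟩ <;>
      simp [List.count_replicate, hab, hab.symm]
  · rintro ⟨v, hv, h1, h2, h⟩
    rw [← h1, ← h2]
    exact (eq_replicate_append_replicate_iff hab).2 hv ▸ h

end IsNatDef

/-! ### Compatible sets of exponents define languages -/

section linear

variable {n B : ℕ} {Y F : Type} [Fintype F]

/-- The exponents `c + ∑ λ_p p`, where the coefficient `λ_p` of the period `p` is the number of
occurrences of the letter `j p` in the word `β p`. -/
def linearExponents (c : Y × Fin n → ℕ) (p : F → Y × Fin n → ℕ) (j : F → Fin n)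
    (β : F → List (Fin n)) (v : Y × Fin n) : ℕ :=
  c v + ∑ i, (β i).count (j i) * p i v

lemma isNatDef_count_runWord_linearExponents (hB : 3 ≤ B) (hn : 2 ≤ n) (c : Y × Fin n → ℕ)
    (p : F → Y × Fin n → ℕ) (j : F → Fin n) (hp : ∀ i v, v.2 ≠ j i → p i v = 0)
    (R : List (Y × Fin n)) (a : Fin n) {ι : Type} (g : F → ι) :
    IsNatDef B a fun α : ι → List (Fin n) =>
      (runWord R (linearExponents c p j fun i => α (g i))).count a := by
  have : Nontrivial (Fin n) := Fin.nontrivial_iff_two_le.2 hn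
  obtain ⟨b, hb⟩ := exists_ne a
  have hab := hb.symm
  simp only [count_runWord]
  refine IsNatDef.list_sum hB hab R fun v _ => ?_
  by_cases hv : v.2 = a
  · simp only [hv, if_true, linearExponents]
    refine (IsNatDef.const (c v)).add hB hab (IsNatDef.finset_sum hB hab _ fun i _ => ?_)
    by_cases hi : j i = a
    · rw [hi]
      exact (IsNatDef.count hB hab (g i)).mul_const hB hab _
    · -- The period `p i` only affects the exponents of letters different from `a`.
      simp only [hp i v (by rw [hv]; exact Ne.symm hi), mul_zero]
      exact IsNatDef.const 0
  · simp only [hv, if_false]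
    exact IsNatDef.const 0

lemma eDef_eq_runWord_linearExponents (hB : 3 ≤ B) (hn : 2 ≤ n) (c : Y × Fin n → ℕ)
    (p : F → Y × Fin n → ℕ) (j : F → Fin n) (hp : ∀ i v, v.2 ≠ j i → p i v = 0)
    (R : List (Y × Fin n)) :
    EDef B fun α : Unit → List (Fin n) =>
      ∃ l : F → ℕ, α () = runWord R fun v => c v + ∑ i, l i * p i v := by
  have key : EDef B fun α : Unit → List (Fin n) => ∃ β : F → List (Fin n),
      (∀ i, ∃ k, β i = List.replicate k (j i)) ∧
      (∀ a, (α ()).count a = (runWord R (linearExponents c p j β)).count a) ∧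
      ∀ a b, a ≠ b → ∀ t : Fin (R.length + 1),
        (List.replicate ((runWord (R.take t) (linearExponents c p j β)).count a) a ++
          List.replicate ((runWord (R.drop t) (linearExponents c p j β)).count b) b).Sublist
          (α ()) := by
    have : Nontrivial (Fin n) := Fin.nontrivial_iff_two_le.2 hn
    have hdef := isNatDef_count_runWord_linearExponents hB hn c p j hp
    refine EDef.exists_family ?_ ?_
    · refine (EDef.forall_finite fun i => EDef.isReplicate (Sum.inr i) (j i)).and
        ((EDef.forall_finite fun a => ?_).and
          (EDef.forall_finite fun a => EDef.forall_finite fun b => EDef.imp_const fun hab =>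
            EDef.forall_finite fun t => ?_))
      · obtain ⟨b, hb⟩ := exists_ne a
        exact IsNatDef.count_eq hB hb.symm (hdef R a Sum.inr) (Sum.inl ())
      · exact IsNatDef.replicate_append_sublist hB hab (hdef _ a Sum.inr) (hdef _ b Sum.inr)
          (Sum.inl ())
    · rintro α β ⟨hβ, -⟩ i
      obtain ⟨k, hk⟩ := hβ i
      exact hk ▸ replicate_mem hB _ _
  refine key.congr fun α => ?_
  simp only [← eq_runWord_iff]
  constructor
  · rintro ⟨l, h⟩
    refine ⟨fun i => List.replicate (l i) (j i), fun i => ⟨_, rfl⟩, ?_⟩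
    rw [h]
    exact runWord_congr fun v _ => by simp [linearExponents]
  · rintro ⟨β, -, h⟩
    exact ⟨_, h⟩

end linear

theorem IsPCompatible.definableSigmaOne {n ℓ : ℕ} (hn : 2 ≤ n) {S : Set (Fin ℓ × Fin n → ℕ)}
    (hS : IsPCompatible (letterPartition ℓ n) S) :
    DefinableSigmaOne 0 ({w | ∃ e ∈ S, w = expWord e} : Language (Fin n)) := by
  obtain ⟨C, hC, rfl⟩ := hS
  refine EDef.definableSigmaOne (B := ℓ + 3) ?_ ?_
  · refine (EDef.exists_mem_finset C (R := fun r (α : Unit → List (Fin n)) =>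
      ∃ l : r.2 → ℕ, α () = runWord (allRuns ℓ n) fun v => r.1 v + ∑ i, l i * i.1 v)
      fun r hr => ?_).congr fun α => ?_
    · choose j hj using fun i : r.2 => hC r hr i.1 i.2
      exact eDef_eq_runWord_linearExponents (by omega) hn r.1 (fun i : r.2 => i.1) j hj _
    · have hmem : ∀ r : (Fin ℓ × Fin n → ℕ) × Finset (Fin ℓ × Fin n → ℕ),
          ∀ e, e ∈ r.1 +ᵥ (AddSubmonoid.closure (r.2 : Set (Fin ℓ × Fin n → ℕ)) :
            Set (Fin ℓ × Fin n → ℕ)) ↔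
          ∃ l : r.2 → ℕ, e = fun v => r.1 v + ∑ i, l i * i.1 v := by
        intro r e
        rw [Set.mem_vadd_set]
        simp only [SetLike.mem_coe, AddSubmonoid.mem_closure_finset']
        constructor
        · rintro ⟨_, ⟨l, rfl⟩, rfl⟩
          exact ⟨l, by ext v; simp [Finset.sum_apply]⟩
        · rintro ⟨l, rfl⟩
          exact ⟨_, ⟨l, rfl⟩, by ext v; simp [Finset.sum_apply]⟩
      constructor
      · rintro ⟨e, he, h⟩
        simp only [Set.mem_iUnion, exists_prop] at he
        obtain ⟨r, hr, he⟩ := he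
        obtain ⟨l, rfl⟩ := (hmem r e).1 he
        exact ⟨r, hr, l, h.trans (expWord_eq_runWord _)⟩
      · rintro ⟨r, hr, l, h⟩
        refine ⟨_, ?_, h.trans (expWord_eq_runWord _).symm⟩
        simp only [Set.mem_iUnion, exists_prop]
        exact ⟨r, hr, (hmem r _).2 ⟨l, rfl⟩⟩
  · rintro w ⟨e, -, rfl⟩
    exact letterBlock_pow_mono (by omega) (expWord_mem e)

/-! ### The languages `{a^k b a^k}` and `{a^k b^k}` -/

lemma definable_replicate_marker_replicate {n : ℕ} (hn : 2 ≤ n) (a b : Fin n) :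
    DefinableSigmaOne 0 ({w | ∃ k : ℕ, w = List.replicate k a ++ [b] ++ List.replicate k a} :
      Language (Fin n)) := by
  classical
  -- The exponents in three blocks `a_1^* ⋯ a_n^*`: the two powers of `a` grow together.
  let base : Fin 3 × Fin n → ℕ := fun v => if v = (1, b) then 1 else 0
  let period : Fin 3 × Fin n → ℕ := fun v => if v.1 ≠ 1 ∧ v.2 = a then 1 else 0
  have hword : ∀ k : ℕ, expWord (base + k • period) =
      List.replicate k a ++ [b] ++ List.replicate k a := by
    intro k
    have h0 : ∀ j, (base + k • period) (0, j) = if j = a then k else 0 := by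
      simp [base, period]
    have h1 : ∀ j, (base + k • period) (1, j) = if j = b then 1 else 0 := by
      simp [base, period]
    have h2 : ∀ j, (base + k • period) (2, j) = if j = a then k else 0 := by
      simp [base, period]
    simp only [expWord, List.ofFn_succ, List.ofFn_zero, Fin.succ_zero_eq_one, Fin.succ_one_eq_two,
      h0, h1, h2, flatten_ofFn_replicate_ite]
    simp
  have hS : IsPCompatible (letterPartition 3 n)
      (base +ᵥ (AddSubmonoid.closure {period} : Set (Fin 3 × Fin n → ℕ))) := by
    refine ⟨{(base, {period})}, fun r hr p hp => ?_, by simp⟩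
    obtain rfl := Finset.mem_singleton.1 hr
    obtain rfl := Finset.mem_singleton.1 hp
    exact ⟨a, fun v hv => if_neg fun h => hv h.2⟩
  refine (congrArg (DefinableSigmaOne 0) ?_).mpr (hS.definableSigmaOne hn)
  ext w
  constructor
  · rintro ⟨k, rfl⟩
    refine ⟨base + k • period, ?_, (hword k).symm⟩
    exact Set.vadd_mem_vadd_set (AddSubmonoid.mem_closure_singleton.2 ⟨k, rfl⟩)
  · rintro ⟨_, ⟨m, hm, rfl⟩, rfl⟩
    obtain ⟨k, rfl⟩ := AddSubmonoid.mem_closure_singleton.1 hm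
    exact ⟨k, hword k⟩

lemma count_expWord_add {ℓ n : ℕ} (x : Fin n) (e e' : Fin ℓ × Fin n → ℕ) :
    (expWord (e + e')).count x = (expWord e).count x + (expWord e').count x := by
  simp only [expWord_eq_runWord, count_runWord, ← List.sum_map_add]
  congr 1
  refine List.map_congr_left fun v _ => ?_
  split_ifs <;> simp

lemma count_expWord_eq_zero {ℓ n : ℕ} (x : Fin n) (e : Fin ℓ × Fin n → ℕ)
    (h : ∀ v, v.2 = x → e v = 0) : (expWord e).count x = 0 := by
  rw [expWord_eq_runWord, count_runWord, List.sum_eq_zero_iff]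
  intro y hy
  obtain ⟨v, -, rfl⟩ := List.mem_map.1 hy
  split_ifs with hv
  exacts [h v hv, rfl]

/-- A period that vanishes outside the block of one letter would change the number of one letter
only, so in a compatible representation of the exponents of `{a^k b^k}` the number of letters `a`
depends on the base only and is thus bounded. -/
lemma not_definable_replicate_append_replicate {n : ℕ} {a b : Fin n} (hab : a ≠ b) :
    ¬ DefinableSigmaOne 0 ({w | ∃ k : ℕ, w = List.replicate k a ++ List.replicate k b} :
      Language (Fin n)) := by
  intro hL
  obtain ⟨C, hC, hS⟩ := isPCompatible_exponents_of_definable hL 2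
  have hcount : ∀ e : Fin 2 × Fin n → ℕ,
      (∃ k : ℕ, expWord e = List.replicate k a ++ List.replicate k b) →
      (expWord e).count a = (expWord e).count b ∧
        ∀ x, x ≠ a → x ≠ b → (expWord e).count x = 0 := by
    rintro e ⟨k, h⟩
    rw [h]
    refine ⟨by simp [List.count_replicate, hab, hab.symm], fun x hxa hxb => ?_⟩
    simp [List.count_replicate, hxa.symm, hxb.symm]
  have hmem : ∀ r ∈ C, ∀ m ∈ AddSubmonoid.closure (r.2 : Set (Fin 2 × Fin n → ℕ)),
      ∃ k : ℕ, expWord (r.1 + m) = List.replicate k a ++ List.replicate k b := by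
    intro r hr m hm
    have : r.1 + m ∈ exponents 2
        ({w | ∃ k : ℕ, w = List.replicate k a ++ List.replicate k b} : Language (Fin n)) := by
      rw [hS]
      exact Set.mem_biUnion hr (Set.vadd_mem_vadd_set hm)
    exact this
  have hperiod : ∀ r ∈ C, ∀ p ∈ r.2, (expWord p).count a = 0 := by
    intro r hr p hp
    obtain ⟨i, hi⟩ := hC r hr p hp
    have hzero : ∀ x, x ≠ i → (expWord p).count x = 0 := fun x hx =>
      count_expWord_eq_zero x p fun v hv => hi v fun h => hx (hv.symm.trans h)
    have h1 := (hcount _ (hmem r hr 0 (zero_mem _))).1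
    have h2 := (hcount _ (hmem r hr p (AddSubmonoid.subset_closure hp))).1
    rw [add_zero] at h1
    rw [count_expWord_add, count_expWord_add] at h2
    by_cases hia : a = i
    · have := hzero b fun h => hab (hia.trans h.symm)
      omega
    · exact hzero a hia
  have hbase : ∀ r ∈ C, ∀ m ∈ AddSubmonoid.closure (r.2 : Set (Fin 2 × Fin n → ℕ)),
      (expWord m).count a = 0 := by
    intro r hr m hm
    induction hm using AddSubmonoid.closure_induction with
    | mem p hp => exact hperiod r hr p hp
    | zero => exact count_expWord_eq_zero a _ fun _ _ => rfl
    | add x y _ _ hx hy => rw [count_expWord_add, hx, hy]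
  let K := (C.sup fun r => (expWord r.1).count a) + 1
  obtain ⟨e, he⟩ := (mem_letterBlock_pow 2 (List.replicate K a ++ List.replicate K b)).1
    (append_mem_letterBlock_pow (p := 1) (q := 1) (replicate_mem_letterBlock a K)
      (replicate_mem_letterBlock b K))
  have heS : e ∈ exponents 2
      ({w | ∃ k : ℕ, w = List.replicate k a ++ List.replicate k b} : Language (Fin n)) :=
    ⟨K, he.symm⟩
  rw [hS] at heS
  simp only [Set.mem_iUnion, exists_prop] at heS
  obtain ⟨r, hr, m, hm, rfl⟩ := heS
  have h1 : (expWord (r.1 + m)).count a = K := by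
    change (expWord (r.1 +ᵥ m)).count a = K
    rw [← he]
    simp [List.count_replicate, hab.symm]
  rw [count_expWord_add, hbase r hr m hm] at h1
  have h2 : (expWord r.1).count a ≤ C.sup fun r => (expWord r.1).count a :=
    Finset.le_sup (f := fun r : (Fin 2 × Fin n → ℕ) × Finset (Fin 2 × Fin n → ℕ) =>
      (expWord r.1).count a) hr
  omega

end SubwordLogic

theorem theorem5p1 (n : ℕ) (hn : 2 ≤ n) :
    (∀ (ℓ : ℕ) (L : Language (Fin n)), L ≤ SubwordLogic.letterBlock n ^ ℓ →
      (SubwordLogic.DefinableSigmaOne 0 L ↔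
        (IsSemilinearSet (SubwordLogic.exponents ℓ L) ∧
          SubwordLogic.IsPCompatible (SubwordLogic.letterPartition ℓ n)
            (SubwordLogic.exponents ℓ L)))) ∧
    (∀ a b : Fin n, a ≠ b →
      SubwordLogic.DefinableSigmaOne 0
        ({w | ∃ k : ℕ, w = List.replicate k a ++ [b] ++ List.replicate k a} :
          Language (Fin n)) ∧
      ¬ SubwordLogic.DefinableSigmaOne 0
        ({w | ∃ k : ℕ, w = List.replicate k a ++ List.replicate k b} : Language (Fin n))) := by
  refine ⟨fun ℓ L hL => ⟨fun h => ?_, fun h => ?_⟩, fun a b hab =>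
    ⟨SubwordLogic.definable_replicate_marker_replicate hn a b,
      SubwordLogic.not_definable_replicate_append_replicate hab⟩⟩
  · have hS := SubwordLogic.isPCompatible_exponents_of_definable h ℓ
    exact ⟨hS.isSemilinearSet, hS⟩
  · refine (congrArg (SubwordLogic.DefinableSigmaOne 0) ?_).mpr (h.2.definableSigmaOne hn)
    ext w
    constructor
    · intro hw
      obtain ⟨e, rfl⟩ := (SubwordLogic.mem_letterBlock_pow ℓ w).1 (hL hw)
      exact ⟨e, hw, rfl⟩
    · rintro ⟨e, he, rfl⟩
      exact he
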